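/- Consider the logic $\mu\mathrm{MALL}^=$: first-order multiplicative-additive linear logic with equality $=$, disequality $\neq$ (over simply typed $\lambda$-terms modulo $\alpha\beta\eta$) and least and greatest fixed points $\mu B\vec t$, $\nu B\vec t$ of monotonic predicate operators $B$ without free term variables. Fix a mapping $csu$ from unification problems to (possibly infinite) complete sets of unifiers, with $csu(t\doteq t)=\{id\}$. Sequents $\Sigma;\vdash\Gamma$ are multisets of formulas, each with a location, the locations being pairwise disjoint; negated atoms and greatest fixed points may moreover be frozen, written $P^*$. Locations form trees: the sublocations of a formula are those of its immediate subformulas, where the immediate subformula of $\mu B\vec t$ is $B(\mu B)\vec t$, and those of $\nu B\vec t$ are the formulas $S\vec t$ for all closed predicates $S$ of the type of $\nu B$; locations do not depend on terms. Derivations are built with the following rules (there is no cut, and frozen formulas are never principal except in the two axioms): the usual rules of MALL for the connectives $\otimes$, $\oplus$, par, $\&$ and the units $\mathbf 1,\bot,\top$ and the usual rules for $\forall,\exists$; the axioms $\Sigma;\vdash t=t$, $\ \Sigma;\vdash (a^\perp\vec t)^*, a\vec t$ and $\Sigma;\vdash(\nu\overline B\vec t)^*,\mu B\vec t$, where $\overline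 B=\lambda p.(Bp^\perp)^\perp$; the freezing rules, deriving $\Sigma;\vdash\Gamma,a^\perp\vec t$ from $\Sigma;\vdash\Gamma,(a^\perp\vec t)^*$ and $\Sigma;\vdash\Gamma,\nu B\vec t$ from $\Sigma;\vdash\Gamma,(\nu B\vec t)^*$ at the same location; the rule deriving $\Sigma;\vdash\Gamma,s\neq t$ from the family $(\Sigma\theta;\vdash\Gamma\theta)_{\theta\in csu(s\doteq t)}$; unfolding, deriving $\Sigma;\vdash\Gamma,\mu B\vec t$ from $\Sigma;\vdash\Gamma,B(\mu B)\vec t$; and coinduction, deriving $\Sigma;\vdash\Gamma,\nu B\vec t$ from $\Sigma;\vdash\Gamma,S\vec t$ and a coinvariance derivation of $\vec x;\vdash BS\vec x,(S\vec x)^\perp$, whose two formulas have new locations; the closed predicate $S$ is called the coinvariant. A derivation is quasi-finite if it has finite height and only uses a finite number of different coinvariants (in the whole derivation, coinvariance subderivations included). It is balanced if it is quasi-finite and every greatest fixed point occurring in it, in coinvariance subderivations too, is used in a balanced way: either all the rule instances of which an occurrence of it (that is, the formula at the same location) is principal are freezing rules, or all of them are coinductions with the same coinvariant. As coinvariance subderivations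 have new locations, this is a condition on each of them separately and on the rest of the derivation. **Lemma.** For every $\Sigma;\vdash\Gamma$ (possibly with frozen formulas), if $\Sigma;\vdash\Gamma$ has a quasi-finite derivation then it has a balanced derivation (of the same sequent, with the same locations). -/

import Mathlib

universe u v w

namespace MuMALL

/-! ## Simply typed terms modulo beta-eta -/

/-- Term types: simple types over the base types `β` (the type of formulas is not one of them). -/
inductive Ty (β : Type u) : Type u
  | base : β → Ty β
  | arrow : Ty β → Ty β → Ty β

/-- The toplevel signature: base types, typed term constants, and atoms (predicate constants)
with the list of the types of their arguments. -/
structure Lang where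
  Base : Type u
  Const : Ty Base → Type v
  Atom : List (Ty Base) → Type w

/-- Typed de Bruijn variables: `Var l a` is the type of positions of the list `l` holding `a`. -/
inductive Var {α : Type u} : List α → α → Type u
  | zero {l : List α} {a : α} : Var (a :: l) a
  | succ {l : List α} {a b : α} : Var l a → Var (b :: l) a

/-- A signature: the list of the types of the universally quantified term variables. -/
abbrev Ctx (L : Lang.{u, v, w}) : Type u := List (Ty L.Base)

/-- Simply typed lambda-terms (up to alpha-conversion, thanks to de Bruijn variables). -/
inductive Raw (L : Lang.{u, v, w}) : Ctx L → Ty L.Base → Type (max u v)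
  | var {V : Ctx L} {a : Ty L.Base} : Var V a → Raw L V a
  | const {V : Ctx L} {a : Ty L.Base} : L.Const a → Raw L V a
  | app {V : Ctx L} {a b : Ty L.Base} : Raw L V (.arrow a b) → Raw L V a → Raw L V b
  | lam {V : Ctx L} {a b : Ty L.Base} : Raw L (a :: V) b → Raw L V (.arrow a b)

variable {L : Lang.{u, v, w}}

/-- Renamings of variables, for term variables and for predicate variables alike. -/
abbrev Ren {α : Type u} (V W : List α) : Type u := ∀ ⦃a : α⦄, Var V a → Var W a

def Ren.lift {α : Type u} {V W : List α} {b : α} (r : Ren V W) : Ren (b :: V) (b :: W)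
  | _, .zero => .zero
  | _, .succ x => .succ (r x)

namespace Raw

def ren : ∀ {V W : Ctx L} {a : Ty L.Base}, Ren V W → Raw L V a → Raw L W a
  | _, _, _, r, .var x => .var (r x)
  | _, _, _, _, .const c => .const c
  | _, _, _, r, .app t s => .app (t.ren r) (s.ren r)
  | _, _, _, r, .lam t => .lam (t.ren r.lift)

def weaken {V : Ctx L} {a b : Ty L.Base} (t : Raw L V a) : Raw L (b :: V) a :=
  t.ren (fun _ x => .succ x)

def liftSub {V W : Ctx L} {b : Ty L.Base} (σ : ∀ ⦃a : Ty L.Base⦄, Var V a → Raw L W a) :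
    ∀ ⦃a : Ty L.Base⦄, Var (b :: V) a → Raw L (b :: W) a
  | _, .zero => .var .zero
  | _, .succ x => (σ x).weaken

/-- Simultaneous capture-avoiding substitution. -/
def subst : ∀ {V W : Ctx L} {a : Ty L.Base},
    (∀ ⦃a : Ty L.Base⦄, Var V a → Raw L W a) → Raw L V a → Raw L W a
  | _, _, _, σ, .var x => σ x
  | _, _, _, _, .const c => .const c
  | _, _, _, σ, .app t s => .app (t.subst σ) (s.subst σ)
  | _, _, _, σ, .lam t => .lam (t.subst (liftSub σ))

def instSub {V : Ctx L} {b : Ty L.Base} (s : Raw L V b) :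
    ∀ ⦃a : Ty L.Base⦄, Var (b :: V) a → Raw L V a
  | _, .zero => s
  | _, .succ x => .var x

/-- Beta-eta-convertibility. -/
inductive Conv : ∀ {V : Ctx L} {a : Ty L.Base}, Raw L V a → Raw L V a → Prop
  | refl {V : Ctx L} {a : Ty L.Base} (t : Raw L V a) : Conv t t
  | symm {V : Ctx L} {a : Ty L.Base} {t s : Raw L V a} : Conv t s → Conv s t
  | trans {V : Ctx L} {a : Ty L.Base} {t s r : Raw L V a} : Conv t s → Conv s r → Conv t r
  | app {V : Ctx L} {a b : Ty L.Base} {t t' : Raw L V (.arrow a b)} {s s' : Raw L V a} :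
      Conv t t' → Conv s s' → Conv (.app t s) (.app t' s')
  | lam {V : Ctx L} {a b : Ty L.Base} {t t' : Raw L (a :: V) b} :
      Conv t t' → Conv (.lam t) (.lam t')
  | beta {V : Ctx L} {a b : Ty L.Base} (t : Raw L (a :: V) b) (s : Raw L V a) :
      Conv (.app (.lam t) s) (t.subst (instSub s))
  | eta {V : Ctx L} {a b : Ty L.Base} (t : Raw L V (.arrow a b)) :
      Conv (.lam (.app t.weaken (.var .zero))) t

theorem ren_ren {V W X : Ctx L} {a : Ty L.Base} (r : Ren V W) (r' : Ren W X) (t : Raw L V a) :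
    (t.ren r).ren r' = t.ren (fun _ x => r' (r x)) := by
  induction t generalizing W X with
  | var x => rfl
  | const c => rfl
  | app t s iht ihs => simp only [ren, iht, ihs]
  | lam t ih =>
    simp only [ren, ih]
    congr 2
    funext a x
    cases x <;> rfl

theorem subst_ren {V W X : Ctx L} {a : Ty L.Base} (r : Ren V W)
    (σ : ∀ ⦃a : Ty L.Base⦄, Var W a → Raw L X a) (t : Raw L V a) :
    (t.ren r).subst σ = t.subst (fun _ x => σ (r x)) := by
  induction t generalizing W X with
  | var x => rfl
  | const c => rfl
  | app t s iht ihs => simp only [ren, subst, iht, ihs]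
  | lam t ih =>
    simp only [ren, subst, ih]
    congr 2
    funext a x
    cases x <;> rfl

theorem ren_subst {V W X : Ctx L} {a : Ty L.Base}
    (σ : ∀ ⦃a : Ty L.Base⦄, Var V a → Raw L W a) (r : Ren W X) (t : Raw L V a) :
    (t.subst σ).ren r = t.subst (fun _ x => (σ x).ren r) := by
  induction t generalizing W X with
  | var x => rfl
  | const c => rfl
  | app t s iht ihs => simp only [ren, subst, iht, ihs]
  | lam t ih =>
    simp only [ren, subst, ih]
    congr 2
    funext a x
    cases x with
    | zero => rfl
    | succ x =>
      simp only [liftSub, weaken, ren_ren]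
      rfl

theorem subst_subst {V W X : Ctx L} {a : Ty L.Base}
    (σ : ∀ ⦃a : Ty L.Base⦄, Var V a → Raw L W a)
    (τ : ∀ ⦃a : Ty L.Base⦄, Var W a → Raw L X a) (t : Raw L V a) :
    (t.subst σ).subst τ = t.subst (fun _ x => (σ x).subst τ) := by
  induction t generalizing W X with
  | var x => rfl
  | const c => rfl
  | app t s iht ihs => simp only [subst, iht, ihs]
  | lam t ih =>
    simp only [subst, ih]
    congr 2
    funext a x
    cases x with
    | zero => rfl
    | succ x =>
      simp only [liftSub, weaken, subst_ren, ren_subst]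

theorem subst_var {V : Ctx L} {a : Ty L.Base} (t : Raw L V a) :
    t.subst (fun _ x => .var x) = t := by
  induction t with
  | var x => rfl
  | const c => rfl
  | app t s iht ihs => simp only [subst, iht, ihs]
  | lam t ih =>
    simp only [subst]
    congr 1
    refine Eq.trans ?_ ih
    congr 1
    funext a x
    cases x <;> rfl

theorem Conv.subst {V W : Ctx L} {a : Ty L.Base} {t s : Raw L V a} (h : Conv t s)
    (σ : ∀ ⦃a : Ty L.Base⦄, Var V a → Raw L W a) : Conv (t.subst σ) (s.subst σ) := by
  induction h generalizing W with
  | refl t => exact .refl _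
  | symm _ ih => exact .symm (ih σ)
  | trans _ _ ih ih' => exact .trans (ih σ) (ih' σ)
  | app _ _ ih ih' => exact .app (ih σ) (ih' σ)
  | lam _ ih => exact .lam (ih _)
  | beta t s =>
    have e : (t.subst (instSub s)).subst σ
        = (t.subst (liftSub σ)).subst (instSub (s.subst σ)) := by
      rw [subst_subst, subst_subst]
      congr 1
      funext a x
      cases x with
      | zero => rfl
      | succ x =>
        simp only [instSub, liftSub, weaken, subst_ren]
        exact (subst_var _).symm
    rw [e]
    exact .beta _ _
  | eta t =>
    refine Eq.subst (motive := fun r => Conv (.lam (.app r (.var .zero))) (t.subst σ)) ?_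
      (.eta (t.subst σ))
    simp only [weaken, subst_ren, ren_subst]
    rfl

theorem Conv.ren {V W : Ctx L} {a : Ty L.Base} {t s : Raw L V a} (h : Conv t s)
    (r : Ren V W) : Conv (t.ren r) (s.ren r) := by
  have e : ∀ t : Raw L V a, t.ren r = t.subst (fun _ x => .var (r x)) := by
    intro t
    conv_lhs => rw [← subst_var (t.ren r), subst_ren]
  rw [e, e]
  exact h.subst _

instance setoid (V : Ctx L) (a : Ty L.Base) : Setoid (Raw L V a) where
  r := Conv
  iseqv := ⟨.refl, .symm, .trans⟩

end Raw

/-- Terms of type `a` under the signature `V`, modulo beta-eta-conversion. -/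
def Tm (L : Lang.{u, v, w}) (V : Ctx L) (a : Ty L.Base) : Type (max u v) :=
  Quotient (Raw.setoid (L := L) V a)

def Tm.var {V : Ctx L} {a : Ty L.Base} (x : Var V a) : Tm L V a := ⟦Raw.var x⟧

def Tm.weaken {V : Ctx L} {a b : Ty L.Base} (t : Tm L V a) : Tm L (b :: V) a :=
  Quotient.map (sa := Raw.setoid V a) (sb := Raw.setoid (b :: V) a)
    Raw.weaken (fun _ _ h => h.ren _) t

/-- Substitutions of domain signature `V` and image signature `W`. A substitution of domain
`[γ₁, …, γₙ]` is also a tuple of terms of types `γ₁, …, γₙ`. -/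
abbrev Sub (L : Lang.{u, v, w}) (V W : Ctx L) : Type (max u v) :=
  ∀ ⦃a : Ty L.Base⦄, Var V a → Tm L W a

noncomputable section

/-- Substitution in terms; the choice of representatives of the `σ x` is irrelevant. -/
def Tm.subst {V W : Ctx L} {a : Ty L.Base} (σ : Sub L V W) (t : Tm L V a) : Tm L W a :=
  Quotient.map (sa := Raw.setoid V a) (sb := Raw.setoid W a)
    (Raw.subst (fun _ x => Quotient.out (σ x))) (fun _ _ h => h.subst _) t

namespace Sub

def id (V : Ctx L) : Sub L V V := fun _ x => .var x

/-- `θ.comp σ` is the substitution written `θσ` in postfix notation: first `θ`, then `σ`. -/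
def comp {V W X : Ctx L} (θ : Sub L V W) (σ : Sub L W X) : Sub L V X :=
  fun _ x => (θ x).subst σ

def lift {V W : Ctx L} {b : Ty L.Base} (σ : Sub L V W) : Sub L (b :: V) (b :: W)
  | _, .zero => .var .zero
  | _, .succ x => (σ x).weaken

/-- The inclusion of a signature in its extension by one variable. -/
def shift (V : Ctx L) (b : Ty L.Base) : Sub L V (b :: V) := fun _ x => .var (.succ x)

/-- `[t/x]`, for the last variable `x`. -/
def inst {V : Ctx L} {b : Ty L.Base} (t : Tm L V b) : Sub L (b :: V) V
  | _, .zero => t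
  | _, .succ x => .var x

end Sub

/-! ## Complete sets of unifiers -/

/-- A fixed mapping from unification problems to complete sets of unifiers, which takes the
identity as the only element for problems of the form `t ≐ t`. -/
structure UnifierSets (L : Lang.{u, v, w}) where
  csu : ∀ {V : Ctx L} {a : Ty L.Base}, Tm L V a → Tm L V a → Set (Σ W : Ctx L, Sub L V W)
  isUnifier : ∀ {V : Ctx L} {a : Ty L.Base} (s t : Tm L V a),
    ∀ θ ∈ csu s t, s.subst θ.2 = t.subst θ.2
  complete : ∀ {V : Ctx L} {a : Ty L.Base} (s t : Tm L V a) {X : Ctx L} (σ : Sub L V X),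
    s.subst σ = t.subst σ → ∃ θ ∈ csu s t, ∃ σ' : Sub L θ.1 X, σ = θ.2.comp σ'
  csu_self : ∀ {V : Ctx L} {a : Ty L.Base} (t : Tm L V a), csu t t = {⟨V, Sub.id V⟩}

/-! ## Formulas -/

/-- Formulas with free predicate variables in `Δ` (given by the lists of the types of their
arguments) and free term variables in `V`.

A predicate of argument types `τ` without free term variables is a formula over the signature `τ`,
and a predicate operator is the body `B p x₁ … xₙ`, a formula whose term variables are exactly
its arguments and with one more predicate variable. All operators are monotonic: there are no
negated predicate variables. -/
inductive Formula (L : Lang.{u, v, w}) : List (Ctx L) → Ctx L → Type (max u v w)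
  | tensor {Δ : List (Ctx L)} {V : Ctx L} : Formula L Δ V → Formula L Δ V → Formula L Δ V
  | plus {Δ : List (Ctx L)} {V : Ctx L} : Formula L Δ V → Formula L Δ V → Formula L Δ V
  | par {Δ : List (Ctx L)} {V : Ctx L} : Formula L Δ V → Formula L Δ V → Formula L Δ V
  | wth {Δ : List (Ctx L)} {V : Ctx L} : Formula L Δ V → Formula L Δ V → Formula L Δ V
  | one {Δ : List (Ctx L)} {V : Ctx L} : Formula L Δ V
  | zero {Δ : List (Ctx L)} {V : Ctx L} : Formula L Δ V
  | bot {Δ : List (Ctx L)} {V : Ctx L} : Formula L Δ V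
  | top {Δ : List (Ctx L)} {V : Ctx L} : Formula L Δ V
  | atom {Δ : List (Ctx L)} {V : Ctx L} {τ : Ctx L} : L.Atom τ → Sub L τ V → Formula L Δ V
  | natom {Δ : List (Ctx L)} {V : Ctx L} {τ : Ctx L} : L.Atom τ → Sub L τ V → Formula L Δ V
  | ex {Δ : List (Ctx L)} {V : Ctx L} {a : Ty L.Base} : Formula L Δ (a :: V) → Formula L Δ V
  | all {Δ : List (Ctx L)} {V : Ctx L} {a : Ty L.Base} : Formula L Δ (a :: V) → Formula L Δ V
  | eq {Δ : List (Ctx L)} {V : Ctx L} {a : Ty L.Base} : Tm L V a → Tm L V a → Formula L Δ V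
  | neq {Δ : List (Ctx L)} {V : Ctx L} {a : Ty L.Base} : Tm L V a → Tm L V a → Formula L Δ V
  | mu {Δ : List (Ctx L)} {V : Ctx L} {τ : Ctx L} :
      Formula L (τ :: Δ) τ → Sub L τ V → Formula L Δ V
  | nu {Δ : List (Ctx L)} {V : Ctx L} {τ : Ctx L} :
      Formula L (τ :: Δ) τ → Sub L τ V → Formula L Δ V
  | pvar {Δ : List (Ctx L)} {V : Ctx L} {τ : Ctx L} : Var Δ τ → Sub L τ V → Formula L Δ V

namespace Formula

/-- Negation. Predicate variables are left unchanged, so on closed formulas and predicates this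
is `P ↦ P^⊥`, and on (the bodies of) operators it is `B ↦ λp. (B p^⊥)^⊥`. -/
def neg : ∀ {Δ : List (Ctx L)} {V : Ctx L}, Formula L Δ V → Formula L Δ V
  | _, _, .tensor P Q => .par P.neg Q.neg
  | _, _, .plus P Q => .wth P.neg Q.neg
  | _, _, .par P Q => .tensor P.neg Q.neg
  | _, _, .wth P Q => .plus P.neg Q.neg
  | _, _, .one => .bot
  | _, _, .zero => .top
  | _, _, .bot => .one
  | _, _, .top => .zero
  | _, _, .atom a ts => .natom a ts
  | _, _, .natom a ts => .atom a ts
  | _, _, .ex P => .all P.neg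
  | _, _, .all P => .ex P.neg
  | _, _, .eq s t => .neq s t
  | _, _, .neq s t => .eq s t
  | _, _, .mu B ts => .nu B.neg ts
  | _, _, .nu B ts => .mu B.neg ts
  | _, _, .pvar p ts => .pvar p ts

/-- Substitution of terms for the free term variables. -/
def tsubst : ∀ {Δ : List (Ctx L)} {V W : Ctx L}, Sub L V W → Formula L Δ V → Formula L Δ W
  | _, _, _, σ, .tensor P Q => .tensor (P.tsubst σ) (Q.tsubst σ)
  | _, _, _, σ, .plus P Q => .plus (P.tsubst σ) (Q.tsubst σ)
  | _, _, _, σ, .par P Q => .par (P.tsubst σ) (Q.tsubst σ)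
  | _, _, _, σ, .wth P Q => .wth (P.tsubst σ) (Q.tsubst σ)
  | _, _, _, _, .one => .one
  | _, _, _, _, .zero => .zero
  | _, _, _, _, .bot => .bot
  | _, _, _, _, .top => .top
  | _, _, _, σ, .atom a ts => .atom a (ts.comp σ)
  | _, _, _, σ, .natom a ts => .natom a (ts.comp σ)
  | _, _, _, σ, .ex P => .ex (P.tsubst σ.lift)
  | _, _, _, σ, .all P => .all (P.tsubst σ.lift)
  | _, _, _, σ, .eq s t => .eq (s.subst σ) (t.subst σ)
  | _, _, _, σ, .neq s t => .neq (s.subst σ) (t.subst σ)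
  | _, _, _, σ, .mu B ts => .mu B (ts.comp σ)
  | _, _, _, σ, .nu B ts => .nu B (ts.comp σ)
  | _, _, _, σ, .pvar p ts => .pvar p (ts.comp σ)

/-- Renaming of predicate variables. -/
def pren : ∀ {Δ Δ' : List (Ctx L)} {V : Ctx L}, Ren Δ Δ' → Formula L Δ V → Formula L Δ' V
  | _, _, _, r, .tensor P Q => .tensor (P.pren r) (Q.pren r)
  | _, _, _, r, .plus P Q => .plus (P.pren r) (Q.pren r)
  | _, _, _, r, .par P Q => .par (P.pren r) (Q.pren r)
  | _, _, _, r, .wth P Q => .wth (P.pren r) (Q.pren r)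
  | _, _, _, _, .one => .one
  | _, _, _, _, .zero => .zero
  | _, _, _, _, .bot => .bot
  | _, _, _, _, .top => .top
  | _, _, _, _, .atom a ts => .atom a ts
  | _, _, _, _, .natom a ts => .natom a ts
  | _, _, _, r, .ex P => .ex (P.pren r)
  | _, _, _, r, .all P => .all (P.pren r)
  | _, _, _, _, .eq s t => .eq s t
  | _, _, _, _, .neq s t => .neq s t
  | _, _, _, r, .mu B ts => .mu (B.pren r.lift) ts
  | _, _, _, r, .nu B ts => .nu (B.pren r.lift) ts
  | _, _, _, r, .pvar p ts => .pvar (r p) ts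

/-- Substitutions of predicates without free term variables for predicate variables. -/
abbrev PSub (L : Lang.{u, v, w}) (Δ Δ' : List (Ctx L)) : Type (max u v w) :=
  ∀ ⦃τ : Ctx L⦄, Var Δ τ → Formula L Δ' τ

def PSub.lift {Δ Δ' : List (Ctx L)} {υ : Ctx L} (ρ : PSub L Δ Δ') : PSub L (υ :: Δ) (υ :: Δ')
  | _, .zero => .pvar .zero (Sub.id _)
  | _, .succ p => (ρ p).pren (fun _ q => .succ q)

/-- Substitution of predicates for predicate variables: `p t⃗` becomes `S t⃗`. -/
def psubst : ∀ {Δ Δ' : List (Ctx L)} {V : Ctx L}, PSub L Δ Δ' → Formula L Δ V → Formula L Δ' V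
  | _, _, _, ρ, .tensor P Q => .tensor (P.psubst ρ) (Q.psubst ρ)
  | _, _, _, ρ, .plus P Q => .plus (P.psubst ρ) (Q.psubst ρ)
  | _, _, _, ρ, .par P Q => .par (P.psubst ρ) (Q.psubst ρ)
  | _, _, _, ρ, .wth P Q => .wth (P.psubst ρ) (Q.psubst ρ)
  | _, _, _, _, .one => .one
  | _, _, _, _, .zero => .zero
  | _, _, _, _, .bot => .bot
  | _, _, _, _, .top => .top
  | _, _, _, _, .atom a ts => .atom a ts
  | _, _, _, _, .natom a ts => .natom a ts
  | _, _, _, ρ, .ex P => .ex (P.psubst ρ)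
  | _, _, _, ρ, .all P => .all (P.psubst ρ)
  | _, _, _, _, .eq s t => .eq s t
  | _, _, _, _, .neq s t => .neq s t
  | _, _, _, ρ, .mu B ts => .mu (B.psubst (PSub.lift ρ)) ts
  | _, _, _, ρ, .nu B ts => .nu (B.psubst (PSub.lift ρ)) ts
  | _, _, _, ρ, .pvar p ts => (ρ p).tsubst ts

def PSub.single {τ : Ctx L} (S : Formula L [] τ) : PSub L [τ] []
  | _, .zero => S

/-- `B S`, the predicate obtained by applying the operator `B` to the closed predicate `S`. -/
def apply {τ : Ctx L} (B : Formula L [τ] τ) (S : Formula L [] τ) : Formula L [] τ :=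
  B.psubst (PSub.single S)

/-- The formulas that can be frozen: negated atoms and greatest fixed points. -/
def Freezable {Δ : List (Ctx L)} {V : Ctx L} : Formula L Δ V → Prop
  | .natom _ _ => True
  | .nu _ _ => True
  | _ => False

end Formula

/-- Closed predicates of arbitrary arity; these are the possible coinvariants. -/
abbrev ClosedPred (L : Lang.{u, v, w}) : Type (max u v w) := Σ τ : Ctx L, Formula L [] τ

/-! ## Locations and sequents -/

/-- The steps from a formula to its immediate subformulas: the components of a binary
connective, the body of a quantifier, the unfolding `B (μB) t⃗` of a least fixed point, and, for
a greatest fixed point, one subformula `S t⃗` for each coinvariant `S`. -/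
inductive Step (L : Lang.{u, v, w}) : Type (max u v w)
  | left | right | body | unfold
  | coinv (S : ClosedPred L)

/-- A location is an address in one of infinitely many trees: a root and a path from it.
It does not depend on terms. -/
structure Location (L : Lang.{u, v, w}) : Type (max u v w) where
  root : ℕ
  path : List (Step L)

namespace Location

def sub (l : Location L) (s : Step L) : Location L := ⟨l.root, l.path ++ [s]⟩

def IsSublocation (m l : Location L) : Prop := m.root = l.root ∧ l.path <+: m.path

/-- Two locations are disjoint when they do not share any sublocation. -/
def Disjoint (l l' : Location L) : Prop := ¬ ∃ m : Location L, m.IsSublocation l ∧ m.IsSublocation l'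

end Location

/-- A closed formula over the signature `V` with its location, frozen or not. -/
structure Entry (L : Lang.{u, v, w}) (V : Ctx L) : Type (max u v w) where
  loc : Location L
  formula : Formula L [] V
  frozen : Bool

def Entry.tsubst {V W : Ctx L} (σ : Sub L V W) (e : Entry L V) : Entry L W :=
  ⟨e.loc, e.formula.tsubst σ, e.frozen⟩

abbrev Sequent (L : Lang.{u, v, w}) (V : Ctx L) : Type (max u v w) := Multiset (Entry L V)

namespace Sequent

def tsubst {V W : Ctx L} (σ : Sub L V W) (Γ : Sequent L V) : Sequent L W :=
  Γ.map (Entry.tsubst σ)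

/-- Locations are pairwise disjoint, and only negated atoms and greatest fixed points are
frozen. -/
def WellFormed {V : Ctx L} (Γ : Sequent L V) : Prop :=
  Γ.Pairwise (fun e e' => e.loc.Disjoint e'.loc) ∧
    ∀ e ∈ Γ, e.frozen = true → e.formula.Freezable

end Sequent

/-- A formula that is not frozen. -/
def act {V : Ctx L} (l : Location L) (P : Formula L [] V) : Entry L V := ⟨l, P, false⟩

/-- A frozen formula. -/
def frz {V : Ctx L} (l : Location L) (P : Formula L [] V) : Entry L V := ⟨l, P, true⟩

/-- The coinvariance sequent `x⃗ ; ⊢ B S x⃗, (S x⃗)^⊥`. Its two locations are new: the locations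
of a coinvariance derivation are never compared to those of another derivation. -/
def coinvarianceSequent {τ : Ctx L} (B : Formula L [τ] τ) (S : Formula L [] τ) : Sequent L τ :=
  {act ⟨0, []⟩ (B.apply S), act ⟨1, []⟩ S.neg}

/-! ## Derivations -/

/-- Freezing-annotated derivations (there is no cut rule). In each rule, `Ω` is the conclusion
sequent and `l` the location of the principal formula. -/
inductive Deriv (U : UnifierSets L) : ∀ {V : Ctx L}, Sequent L V → Type (max u v w)
  | initAtom {V : Ctx L} {Ω : Sequent L V} {τ : Ctx L} (l l' : Location L) (a : L.Atom τ)
      (ts : Sub L τ V) (h : Ω = {frz l (.natom a ts), act l' (.atom a ts)}) : Deriv U Ω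
  | initFix {V : Ctx L} {Ω : Sequent L V} {τ : Ctx L} (l l' : Location L) (B : Formula L [τ] τ)
      (ts : Sub L τ V) (h : Ω = {frz l (.nu B.neg ts), act l' (.mu B ts)}) : Deriv U Ω
  | freezeAtom {V : Ctx L} {Ω : Sequent L V} {τ : Ctx L} (Γ : Sequent L V) (l : Location L)
      (a : L.Atom τ) (ts : Sub L τ V) (h : Ω = act l (.natom a ts) ::ₘ Γ)
      (D : Deriv U (frz l (.natom a ts) ::ₘ Γ)) : Deriv U Ω
  | freezeNu {V : Ctx L} {Ω : Sequent L V} {τ : Ctx L} (Γ : Sequent L V) (l : Location L)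
      (B : Formula L [τ] τ) (ts : Sub L τ V) (h : Ω = act l (.nu B ts) ::ₘ Γ)
      (D : Deriv U (frz l (.nu B ts) ::ₘ Γ)) : Deriv U Ω
  | bot {V : Ctx L} {Ω : Sequent L V} (Γ : Sequent L V) (l : Location L)
      (h : Ω = act l .bot ::ₘ Γ) (D : Deriv U Γ) : Deriv U Ω
  | par {V : Ctx L} {Ω : Sequent L V} (Γ : Sequent L V) (l : Location L) (P Q : Formula L [] V)
      (h : Ω = act l (.par P Q) ::ₘ Γ)
      (D : Deriv U (act (l.sub .left) P ::ₘ act (l.sub .right) Q ::ₘ Γ)) : Deriv U Ω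
  | tensor {V : Ctx L} {Ω : Sequent L V} (Γ Γ' : Sequent L V) (l : Location L)
      (P Q : Formula L [] V) (h : Ω = act l (.tensor P Q) ::ₘ (Γ + Γ'))
      (D : Deriv U (act (l.sub .left) P ::ₘ Γ)) (D' : Deriv U (act (l.sub .right) Q ::ₘ Γ')) :
      Deriv U Ω
  | one {V : Ctx L} {Ω : Sequent L V} (l : Location L) (h : Ω = {act l .one}) : Deriv U Ω
  | top {V : Ctx L} {Ω : Sequent L V} (Γ : Sequent L V) (l : Location L)
      (h : Ω = act l .top ::ₘ Γ) : Deriv U Ω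
  | wth {V : Ctx L} {Ω : Sequent L V} (Γ : Sequent L V) (l : Location L) (P Q : Formula L [] V)
      (h : Ω = act l (.wth P Q) ::ₘ Γ)
      (D : Deriv U (act (l.sub .left) P ::ₘ Γ)) (D' : Deriv U (act (l.sub .right) Q ::ₘ Γ)) :
      Deriv U Ω
  | plusLeft {V : Ctx L} {Ω : Sequent L V} (Γ : Sequent L V) (l : Location L)
      (P Q : Formula L [] V) (h : Ω = act l (.plus P Q) ::ₘ Γ)
      (D : Deriv U (act (l.sub .left) P ::ₘ Γ)) : Deriv U Ω
  | plusRight {V : Ctx L} {Ω : Sequent L V} (Γ : Sequent L V) (l : Location L)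
      (P Q : Formula L [] V) (h : Ω = act l (.plus P Q) ::ₘ Γ)
      (D : Deriv U (act (l.sub .right) Q ::ₘ Γ)) : Deriv U Ω
  | all {V : Ctx L} {Ω : Sequent L V} {a : Ty L.Base} (Γ : Sequent L V) (l : Location L)
      (P : Formula L [] (a :: V)) (h : Ω = act l (.all P) ::ₘ Γ)
      (D : Deriv U (act (l.sub .body) P ::ₘ Γ.tsubst (Sub.shift V a))) : Deriv U Ω
  | ex {V : Ctx L} {Ω : Sequent L V} {a : Ty L.Base} (Γ : Sequent L V) (l : Location L)
      (P : Formula L [] (a :: V)) (t : Tm L V a) (h : Ω = act l (.ex P) ::ₘ Γ)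
      (D : Deriv U (act (l.sub .body) (P.tsubst (Sub.inst t)) ::ₘ Γ)) : Deriv U Ω
  | neq {V : Ctx L} {Ω : Sequent L V} {a : Ty L.Base} (Γ : Sequent L V) (l : Location L)
      (s t : Tm L V a) (h : Ω = act l (.neq s t) ::ₘ Γ)
      (D : ∀ θ : U.csu s t, Deriv U (Γ.tsubst θ.1.2)) : Deriv U Ω
  | eq {V : Ctx L} {Ω : Sequent L V} {a : Ty L.Base} (l : Location L) (t : Tm L V a)
      (h : Ω = {act l (.eq t t)}) : Deriv U Ω
  | mu {V : Ctx L} {Ω : Sequent L V} {τ : Ctx L} (Γ : Sequent L V) (l : Location L)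
      (B : Formula L [τ] τ) (ts : Sub L τ V) (h : Ω = act l (.mu B ts) ::ₘ Γ)
      (D : Deriv U (act (l.sub .unfold) ((B.apply (.mu B (Sub.id τ))).tsubst ts) ::ₘ Γ)) :
      Deriv U Ω
  | nu {V : Ctx L} {Ω : Sequent L V} {τ : Ctx L} (Γ : Sequent L V) (l : Location L)
      (B : Formula L [τ] τ) (ts : Sub L τ V) (S : Formula L [] τ)
      (h : Ω = act l (.nu B ts) ::ₘ Γ)
      (D : Deriv U (act (l.sub (.coinv ⟨τ, S⟩)) (S.tsubst ts) ::ₘ Γ))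
      (E : Deriv U (coinvarianceSequent B S)) : Deriv U Ω

/-- The two ways in which a greatest fixed point can be principal. -/
inductive Usage (L : Lang.{u, v, w}) : Type (max u v w)
  | frozen
  | coinducted (S : ClosedPred L)

namespace Deriv

variable {U : UnifierSets L}

/-- The height of a derivation, coinvariance subderivations included. -/
def height : ∀ {V : Ctx L} {Ω : Sequent L V}, Deriv U Ω → ℕ∞
  | _, _, .initAtom .. => 1
  | _, _, .initFix .. => 1
  | _, _, .freezeAtom _ _ _ _ _ D => D.height + 1
  | _, _, .freezeNu _ _ _ _ _ D => D.height + 1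
  | _, _, .bot _ _ _ D => D.height + 1
  | _, _, .par _ _ _ _ _ D => D.height + 1
  | _, _, .tensor _ _ _ _ _ _ D D' => max D.height D'.height + 1
  | _, _, .one .. => 1
  | _, _, .top .. => 1
  | _, _, .wth _ _ _ _ _ D D' => max D.height D'.height + 1
  | _, _, .plusLeft _ _ _ _ _ D => D.height + 1
  | _, _, .plusRight _ _ _ _ _ D => D.height + 1
  | _, _, .all _ _ _ _ D => D.height + 1
  | _, _, .ex _ _ _ _ _ D => D.height + 1
  | _, _, .neq _ _ _ _ _ D => (⨆ θ, (D θ).height) + 1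
  | _, _, .eq .. => 1
  | _, _, .mu _ _ _ _ _ D => D.height + 1
  | _, _, .nu _ _ _ _ _ _ D E => max D.height E.height + 1

/-- The coinvariants used in a derivation, including in its coinvariance subderivations. -/
def coinvariants : ∀ {V : Ctx L} {Ω : Sequent L V}, Deriv U Ω → Set (ClosedPred L)
  | _, _, .initAtom .. => ∅
  | _, _, .initFix .. => ∅
  | _, _, .freezeAtom _ _ _ _ _ D => D.coinvariants
  | _, _, .freezeNu _ _ _ _ _ D => D.coinvariants
  | _, _, .bot _ _ _ D => D.coinvariants
  | _, _, .par _ _ _ _ _ D => D.coinvariants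
  | _, _, .tensor _ _ _ _ _ _ D D' => D.coinvariants ∪ D'.coinvariants
  | _, _, .one .. => ∅
  | _, _, .top .. => ∅
  | _, _, .wth _ _ _ _ _ D D' => D.coinvariants ∪ D'.coinvariants
  | _, _, .plusLeft _ _ _ _ _ D => D.coinvariants
  | _, _, .plusRight _ _ _ _ _ D => D.coinvariants
  | _, _, .all _ _ _ _ D => D.coinvariants
  | _, _, .ex _ _ _ _ _ D => D.coinvariants
  | _, _, .neq _ _ _ _ _ D => ⋃ θ, (D θ).coinvariants
  | _, _, .eq .. => ∅
  | _, _, .mu _ _ _ _ _ D => D.coinvariants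
  | _, _, .nu (τ := τ) _ _ _ _ S _ D E => {⟨τ, S⟩} ∪ D.coinvariants ∪ E.coinvariants

/-- The uses of greatest fixed points: the pairs `(l, k)` such that a greatest fixed point at
location `l` is principal in a rule instance of kind `k`. Coinvariance subderivations are
skipped, since their locations are new. -/
def uses : ∀ {V : Ctx L} {Ω : Sequent L V}, Deriv U Ω → Set (Location L × Usage L)
  | _, _, .initAtom .. => ∅
  | _, _, .initFix .. => ∅
  | _, _, .freezeAtom _ _ _ _ _ D => D.uses
  | _, _, .freezeNu _ l _ _ _ D => {(l, .frozen)} ∪ D.uses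
  | _, _, .bot _ _ _ D => D.uses
  | _, _, .par _ _ _ _ _ D => D.uses
  | _, _, .tensor _ _ _ _ _ _ D D' => D.uses ∪ D'.uses
  | _, _, .one .. => ∅
  | _, _, .top .. => ∅
  | _, _, .wth _ _ _ _ _ D D' => D.uses ∪ D'.uses
  | _, _, .plusLeft _ _ _ _ _ D => D.uses
  | _, _, .plusRight _ _ _ _ _ D => D.uses
  | _, _, .all _ _ _ _ D => D.uses
  | _, _, .ex _ _ _ _ _ D => D.uses
  | _, _, .neq _ _ _ _ _ D => ⋃ θ, (D θ).uses
  | _, _, .eq .. => ∅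
  | _, _, .mu _ _ _ _ _ D => D.uses
  | _, _, .nu (τ := τ) _ l _ _ S _ D _ => {(l, .coinducted ⟨τ, S⟩)} ∪ D.uses

/-- Outside of coinvariance subderivations, all principal occurrences of a same greatest fixed
point are used consistently: all frozen, or all coinducted on with the same coinvariant. -/
def Consistent {V : Ctx L} {Ω : Sequent L V} (D : Deriv U Ω) : Prop :=
  ∀ (l : Location L) (k k' : Usage L), (l, k) ∈ D.uses → (l, k') ∈ D.uses → k = k'

/-- All coinvariance subderivations, at any depth, are consistent. -/
def CoinvarianceConsistent : ∀ {V : Ctx L} {Ω : Sequent L V}, Deriv U Ω → Prop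
  | _, _, .initAtom .. => True
  | _, _, .initFix .. => True
  | _, _, .freezeAtom _ _ _ _ _ D => D.CoinvarianceConsistent
  | _, _, .freezeNu _ _ _ _ _ D => D.CoinvarianceConsistent
  | _, _, .bot _ _ _ D => D.CoinvarianceConsistent
  | _, _, .par _ _ _ _ _ D => D.CoinvarianceConsistent
  | _, _, .tensor _ _ _ _ _ _ D D' => D.CoinvarianceConsistent ∧ D'.CoinvarianceConsistent
  | _, _, .one .. => True
  | _, _, .top .. => True
  | _, _, .wth _ _ _ _ _ D D' => D.CoinvarianceConsistent ∧ D'.CoinvarianceConsistent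
  | _, _, .plusLeft _ _ _ _ _ D => D.CoinvarianceConsistent
  | _, _, .plusRight _ _ _ _ _ D => D.CoinvarianceConsistent
  | _, _, .all _ _ _ _ D => D.CoinvarianceConsistent
  | _, _, .ex _ _ _ _ _ D => D.CoinvarianceConsistent
  | _, _, .neq _ _ _ _ _ D => ∀ θ, (D θ).CoinvarianceConsistent
  | _, _, .eq .. => True
  | _, _, .mu _ _ _ _ _ D => D.CoinvarianceConsistent
  | _, _, .nu _ _ _ _ _ _ D E =>
      D.CoinvarianceConsistent ∧ E.CoinvarianceConsistent ∧ E.Consistent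

/-- Finite height and finitely many coinvariants (derivations are cut-free by construction). -/
def QuasiFinite {V : Ctx L} {Ω : Sequent L V} (D : Deriv U Ω) : Prop :=
  D.height < ⊤ ∧ D.coinvariants.Finite

/-- Quasi-finite, and all greatest fixed points that occur in the derivation, coinvariance
subderivations included, are used in a balanced way. -/
def Balanced {V : Ctx L} {Ω : Sequent L V} (D : Deriv U Ω) : Prop :=
  D.QuasiFinite ∧ D.Consistent ∧ D.CoinvarianceConsistent

end Deriv

end

end MuMALL

namespace MuMALL

variable {L : Lang.{u, v, w}}

/-! A greatest fixed point may be treated in different ways on different branches. The remedy is to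
coinduct on every `νB` with one coinvariant, a sum `νB ⊕ (νB ⊕ … ⊕ νB)` with a copy for each
coinvariant of the right arity used in the given derivation, and one more copy for freezing. An
original coinduction with `S` becomes: coinduct with the sum, select the copy reserved for `S`,
coinduct on it with `S`. An original freezing selects and freezes the last copy. Copies have
distinct locations, so no location receives two kinds of use.

The sum `C` is a coinvariant (`exists_balanced_copies`): its negation is an iterated `&` of copies
of the dual least fixed point `μB̄`, so it suffices to derive `BC, μB̄`, that is, after unfolding,
`BC, B̄(μB̄)`. Functoriality of `B` (`Linkable.psubst`) reduces this to `C t⃗, μB̄ t⃗`, closed by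
choosing a copy, freezing it and applying the axiom. These derivations must be balanced too, so
functoriality is proved with a record of the use of each location.

Balance of the transformed derivation comes from an automaton on locations (`Stage`): what a
location holds, up to terms, and how it is used are a function of the path to it. Each transformed
derivation has its uses in the set so prescribed (`Deriv.exists_bounded`), and that set is
functional as soon as the root locations are disjoint (`Sequent.uses_functional`).

Quasi-finiteness needs bounds uniform over the possibly infinite branching of the disequality rule.
Operators contain no free term variables, so only finitely many `B` are met within the height of the
derivation (`Formula.operators_finite`); this bounds the new coinvariants and the heights of their
coinvariance derivations. -/

/-! ### Substitution laws for terms modulo conversion. -/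

theorem Raw.Conv.subst_congr {V W : Ctx L} {a : Ty L.Base}
    {σ τ : ∀ ⦃a : Ty L.Base⦄, Var V a → Raw L W a} (h : ∀ ⦃a⦄ (x : Var V a), Conv (σ x) (τ x))
    (t : Raw L V a) : Conv (t.subst σ) (t.subst τ) := by
  induction t generalizing W with
  | var x => exact h x
  | const c => exact .refl _
  | app t s iht ihs => exact .app (iht h) (ihs h)
  | lam t ih =>
    refine .lam (ih ?_)
    intro a x
    cases x with
    | zero => exact .refl _
    | succ x => exact (h x).ren _

/-- `Tm.subst` picks representatives with `Quotient.out`. Convertible substitutions yield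
convertible terms, so any other representatives may be used, and the laws proved for `Raw` pass to
the quotient. -/
theorem Tm.subst_mk {V W : Ctx L} {a : Ty L.Base} (σ : Sub L V W)
    (τ : ∀ ⦃a : Ty L.Base⦄, Var V a → Raw L W a) (h : ∀ ⦃a⦄ (x : Var V a), σ x = ⟦τ x⟧)
    (t : Raw L V a) : Tm.subst σ (⟦t⟧ : Tm L V a) = (⟦t.subst τ⟧ : Tm L W a) := by
  refine Quotient.sound (s := Raw.setoid W a) (Raw.Conv.subst_congr (fun b x => ?_) t)
  have := Quotient.out_eq (s := Raw.setoid W b) (σ x)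
  rw [h x] at this ⊢
  exact Quotient.exact (s := Raw.setoid W b) this

theorem Sub.exists_raw {V W : Ctx L} (σ : Sub L V W) :
    ∃ τ : ∀ ⦃a : Ty L.Base⦄, Var V a → Raw L W a, ∀ ⦃a⦄ (x : Var V a), σ x = ⟦τ x⟧ :=
  ⟨fun a x => Quotient.out (s := Raw.setoid W a) (σ x),
    fun a x => (Quotient.out_eq (s := Raw.setoid W a) (σ x)).symm⟩

theorem Tm.subst_var {V W : Ctx L} {a : Ty L.Base} (σ : Sub L V W) (x : Var V a) :
    (Tm.var x).subst σ = σ x := by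
  obtain ⟨τ, h⟩ := σ.exists_raw
  rw [h x]
  exact Tm.subst_mk σ τ h _

theorem Tm.subst_id {V : Ctx L} {a : Ty L.Base} (t : Tm L V a) : t.subst (Sub.id V) = t := by
  induction t using Quotient.inductionOn with
  | _ t =>
    refine (Tm.subst_mk (Sub.id V) (fun _ x => .var x) (fun _ _ => rfl) t).trans ?_
    rw [Raw.subst_var]

theorem Tm.subst_subst {V W X : Ctx L} {a : Ty L.Base} (σ : Sub L V W) (σ' : Sub L W X)
    (t : Tm L V a) : (t.subst σ).subst σ' = t.subst (σ.comp σ') := by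
  obtain ⟨τ, h⟩ := σ.exists_raw
  obtain ⟨τ', h'⟩ := σ'.exists_raw
  induction t using Quotient.inductionOn with
  | _ t =>
    erw [Tm.subst_mk σ τ h t, Tm.subst_mk σ' τ' h' _,
      Tm.subst_mk (σ.comp σ') (fun _ x => (τ x).subst τ') (fun b x => ?_) t, Raw.subst_subst]
    rw [Sub.comp, h x]
    exact Tm.subst_mk σ' τ' h' _

theorem Tm.weaken_eq_subst {V : Ctx L} {a b : Ty L.Base} (t : Tm L V a) :
    t.weaken (b := b) = t.subst (Sub.shift V b) := by
  induction t using Quotient.inductionOn with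
  | _ t =>
    refine Eq.trans ?_ (Tm.subst_mk (Sub.shift V b) (fun _ x => .var (.succ x))
      (fun _ _ => rfl) t).symm
    change (⟦t.ren _⟧ : Tm L (b :: V) a) = _
    rw [← Raw.subst_var (t.ren _), Raw.subst_ren]

namespace Sub

theorem id_comp {V W : Ctx L} (σ : Sub L V W) : (id V).comp σ = σ := by
  funext a x
  exact Tm.subst_var σ x

theorem comp_id {V W : Ctx L} (σ : Sub L V W) : σ.comp (id W) = σ := by
  funext a x
  exact Tm.subst_id _

theorem comp_assoc {V W X Y : Ctx L} (σ : Sub L V W) (τ : Sub L W X) (υ : Sub L X Y) :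
    (σ.comp τ).comp υ = σ.comp (τ.comp υ) := by
  funext a x
  exact Tm.subst_subst _ _ _

theorem lift_id {V : Ctx L} {b : Ty L.Base} : (id V).lift (b := b) = id (b :: V) := by
  funext a x
  cases x <;> rfl

theorem lift_comp_lift {V W X : Ctx L} {b : Ty L.Base} (σ : Sub L V W) (τ : Sub L W X) :
    (σ.lift (b := b)).comp τ.lift = (σ.comp τ).lift := by
  funext a x
  cases x with
  | zero => exact Tm.subst_var _ _
  | succ x =>
    simp only [comp, lift, Tm.weaken_eq_subst, Tm.subst_subst]
    congr 1
    funext c y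
    simp only [comp, shift, Tm.subst_var, lift, Tm.weaken_eq_subst]

theorem lift_shift_comp_inst {V : Ctx L} {b : Ty L.Base} :
    ((shift V b).lift (b := b)).comp (inst (.var .zero)) = id (b :: V) := by
  funext a x
  cases x with
  | zero => exact Tm.subst_var _ _
  | succ x =>
    simp only [comp, lift, Tm.weaken_eq_subst, Tm.subst_var, shift]
    rfl

end Sub

/-! ### Negation and substitution laws for formulas and predicate variables. -/

namespace Formula

theorem neg_neg {Δ : List (Ctx L)} {V : Ctx L} (P : Formula L Δ V) : P.neg.neg = P := by
  induction P <;> simp only [neg, *]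

theorem tsubst_id {Δ : List (Ctx L)} {V : Ctx L} (P : Formula L Δ V) :
    P.tsubst (Sub.id V) = P := by
  induction P <;> simp only [tsubst, Sub.comp_id, Sub.lift_id, Tm.subst_id, *]

theorem tsubst_tsubst {Δ : List (Ctx L)} {V W X : Ctx L} (σ : Sub L V W) (τ : Sub L W X)
    (P : Formula L Δ V) : (P.tsubst σ).tsubst τ = P.tsubst (σ.comp τ) := by
  induction P generalizing W X <;>
    simp only [tsubst, Sub.comp_assoc, Sub.lift_comp_lift, Tm.subst_subst, *]

theorem pren_tsubst {Δ Δ' : List (Ctx L)} {V W : Ctx L} (r : Ren Δ Δ') (σ : Sub L V W)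
    (P : Formula L Δ V) : (P.tsubst σ).pren r = (P.pren r).tsubst σ := by
  induction P generalizing W Δ' <;> simp only [tsubst, pren, *]

theorem psubst_tsubst {Δ Δ' : List (Ctx L)} {V W : Ctx L} (ρ : PSub L Δ Δ') (σ : Sub L V W)
    (P : Formula L Δ V) : (P.tsubst σ).psubst ρ = (P.psubst ρ).tsubst σ := by
  induction P generalizing W Δ' <;> simp only [tsubst, psubst, tsubst_tsubst, *]

theorem pren_pren {Δ Δ' Δ'' : List (Ctx L)} {V : Ctx L} (r : Ren Δ Δ') (r' : Ren Δ' Δ'')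
    (P : Formula L Δ V) : (P.pren r).pren r' = P.pren (fun _ p => r' (r p)) := by
  have lift : ∀ {Δ Δ' Δ'' : List (Ctx L)} {υ : Ctx L} (r : Ren Δ Δ') (r' : Ren Δ' Δ''),
      (fun _ p => r'.lift (r.lift p) : Ren (υ :: Δ) (υ :: Δ'')) =
        Ren.lift (fun _ p => r' (r p)) := by
    intros
    funext _ p
    cases p <;> rfl
  induction P generalizing Δ' Δ'' <;> simp only [pren, *]

theorem psubst_pren {Δ Δ' Δ'' : List (Ctx L)} {V : Ctx L} (r : Ren Δ Δ') (ρ : PSub L Δ' Δ'')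
    (P : Formula L Δ V) : (P.pren r).psubst ρ = P.psubst (fun _ p => ρ (r p)) := by
  have lift : ∀ {Δ Δ' Δ'' : List (Ctx L)} {υ : Ctx L} (r : Ren Δ Δ') (ρ : PSub L Δ' Δ''),
      (fun _ p => ρ.lift (r.lift p) : PSub L (υ :: Δ) (υ :: Δ'')) =
        PSub.lift (fun _ p => ρ (r p)) := by
    intros
    funext _ p
    cases p <;> rfl
  induction P generalizing Δ' Δ'' <;> simp only [pren, psubst, *]

theorem pren_psubst {Δ Δ' Δ'' : List (Ctx L)} {V : Ctx L} (ρ : PSub L Δ Δ') (r : Ren Δ' Δ'')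
    (P : Formula L Δ V) : (P.psubst ρ).pren r = P.psubst (fun _ p => (ρ p).pren r) := by
  have lift : ∀ {Δ Δ' Δ'' : List (Ctx L)} {υ : Ctx L} (ρ : PSub L Δ Δ') (r : Ren Δ' Δ''),
      (fun _ p => (ρ.lift p).pren r.lift : PSub L (υ :: Δ) (υ :: Δ'')) =
        PSub.lift (fun _ p => (ρ p).pren r) := by
    intros
    funext _ p
    cases p with
    | zero => rfl
    | succ p =>
      simp only [PSub.lift, pren_pren]
      rfl
  induction P generalizing Δ' Δ'' <;> simp only [pren, psubst, pren_tsubst, *]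

theorem psubst_psubst {Δ Δ' Δ'' : List (Ctx L)} {V : Ctx L} (ρ : PSub L Δ Δ')
    (ρ' : PSub L Δ' Δ'') (P : Formula L Δ V) :
    (P.psubst ρ).psubst ρ' = P.psubst (fun _ p => (ρ p).psubst ρ') := by
  have lift : ∀ {Δ Δ' Δ'' : List (Ctx L)} {υ : Ctx L} (ρ : PSub L Δ Δ') (ρ' : PSub L Δ' Δ''),
      (fun _ p => (ρ.lift p).psubst ρ'.lift : PSub L (υ :: Δ) (υ :: Δ'')) =
        PSub.lift (fun _ p => (ρ p).psubst ρ') := by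
    intros
    funext _ p
    cases p with
    | zero => simp only [PSub.lift, psubst, tsubst_id]
    | succ p => simp only [PSub.lift, psubst_pren, pren_psubst]
  induction P generalizing Δ' Δ'' <;> simp only [psubst, psubst_tsubst, *]

theorem psubst_pvar {Δ : List (Ctx L)} {V : Ctx L} (P : Formula L Δ V) :
    P.psubst (fun _ p => .pvar p (Sub.id _)) = P := by
  have lift : ∀ {Δ : List (Ctx L)} {υ : Ctx L},
      (PSub.lift (fun _ p => .pvar p (Sub.id _)) : PSub L (υ :: Δ) (υ :: Δ)) =
        fun _ p => .pvar p (Sub.id _) := by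
    intros
    funext _ p
    cases p <;> rfl
  induction P <;> simp only [psubst, tsubst, Sub.id_comp, *]

/-- The extension of a substitution of predicates by one predicate. -/
def PSub.cons {Δ Δ' : List (Ctx L)} {τ : Ctx L} (S : Formula L Δ' τ) (ρ : PSub L Δ Δ') :
    PSub L (τ :: Δ) Δ'
  | _, .zero => S
  | _, .succ p => ρ p

/-- Makes the unfolding of a substituted fixed point a substitution instance of its body, to which
the induction hypothesis of functoriality applies. -/
theorem psubst_lift_apply {Δ : List (Ctx L)} {τ : Ctx L} (ρ : PSub L Δ [])
    (B : Formula L (τ :: Δ) τ) (S : Formula L [] τ) :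
    (B.psubst ρ.lift).apply S = B.psubst (ρ.cons S) := by
  rw [apply, psubst_psubst]
  congr 1
  funext υ p
  cases p with
  | zero => exact tsubst_id S
  | succ p =>
    simp only [PSub.lift, PSub.cons, psubst_pren]
    refine Eq.trans ?_ (psubst_pvar _)
    congr 1
    funext _ q
    cases q

end Formula

/-! ### Sublocations and maps recording how they are used. -/

namespace Location

/-- The sublocation at the end of a path. -/
def ext (l : Location L) (p : List (Step L)) : Location L := ⟨l.root, l.path ++ p⟩

theorem ext_nil (l : Location L) : l.ext [] = l := by simp [ext]

theorem sub_ext (l : Location L) (s : Step L) (p : List (Step L)) :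
    (l.sub s).ext p = l.ext (s :: p) := by simp [ext, sub]

theorem ext_injective (l : Location L) {p q : List (Step L)} (h : l.ext p = l.ext q) : p = q := by
  simpa [ext] using h

theorem Disjoint.ext_ne {l l' : Location L} (h : l.Disjoint l') (p q : List (Step L)) :
    l.ext p ≠ l'.ext q := fun e =>
  h ⟨l.ext p, ⟨rfl, List.prefix_append _ _⟩, e ▸ ⟨rfl, List.prefix_append _ _⟩⟩

theorem disjoint_of_root_ne {l l' : Location L} (h : l.root ≠ l'.root) : l.Disjoint l' :=
  fun ⟨_, h1, h2⟩ => h (h1.1.symm.trans h2.1)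

end Location

/-- A description of the uses of greatest fixed points at the sublocations of a location, given
by their paths. -/
abbrev UsageMap (L : Lang.{u, v, w}) : Type (max u v w) := List (Step L) → Option (Usage L)

namespace UsageMap

def empty : UsageMap L := fun _ => none

/-- The map with a given usage at the root and given maps after each step. -/
def node (k : Option (Usage L)) (f : Step L → UsageMap L) : UsageMap L
  | [] => k
  | s :: p => f s p

def branch (A B : UsageMap L) : UsageMap L :=
  node none fun
    | .left => A
    | .right => B
    | _ => empty

/-- The same map after all steps. -/
def after (k : Option (Usage L)) (A : UsageMap L) : UsageMap L := node k fun _ => A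

/-- The uses described by a map at a given location. -/
def at_ (A : UsageMap L) (l : Location L) : Set (Location L × Usage L) :=
  {x | ∃ p, x.1 = l.ext p ∧ A p = some x.2}

theorem at_sub_subset (A : UsageMap L) (l : Location L) (s : Step L) (k : Option (Usage L))
    (f : Step L → UsageMap L) (h : f s = A) : A.at_ (l.sub s) ⊆ (node k f).at_ l := by
  rintro x ⟨p, hp, hk⟩
  exact ⟨s :: p, hp.trans (l.sub_ext s p), by subst h; exact hk⟩

theorem mem_at_self (A : UsageMap L) (l : Location L) {k : Usage L} (h : A [] = some k) :
    (l, k) ∈ A.at_ l := ⟨[], l.ext_nil.symm, h⟩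

theorem at_left_subset (A B : UsageMap L) (l : Location L) :
    A.at_ (l.sub .left) ⊆ (branch A B).at_ l := at_sub_subset _ _ _ _ _ rfl

theorem at_right_subset (A B : UsageMap L) (l : Location L) :
    B.at_ (l.sub .right) ⊆ (branch A B).at_ l := at_sub_subset _ _ _ _ _ rfl

theorem at_after_subset (k : Option (Usage L)) (A : UsageMap L) (l : Location L) (s : Step L) :
    A.at_ (l.sub s) ⊆ (after k A).at_ l := at_sub_subset _ _ _ _ _ rfl

/-- A location determines its path from `l`, and a map gives at most one use to a path; uses
described by a map are therefore consistent. -/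
theorem at_functional (A : UsageMap L) {l m : Location L} {k k' : Usage L}
    (h : (m, k) ∈ A.at_ l) (h' : (m, k') ∈ A.at_ l) : k = k' := by
  obtain ⟨p, hp, hk⟩ := h
  obtain ⟨q, hq, hk'⟩ := h'
  obtain rfl := l.ext_injective (hp.symm.trans hq)
  exact Option.some.inj (hk.symm.trans hk')

end UsageMap

open UsageMap

variable {U : UnifierSets L}

/-! ### Derivations of two-formula sequents with recorded uses. -/

namespace Deriv

/-- Quasi-finite derivations whose coinvariance subderivations are consistent, and whose uses of
greatest fixed points belong to a given set. -/
def Nice {V : Ctx L} {Ω : Sequent L V} (D : Deriv U Ω) (W : Set (Location L × Usage L)) : Prop :=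
  D.height < ⊤ ∧ D.coinvariants.Finite ∧ D.CoinvarianceConsistent ∧ D.uses ⊆ W

theorem Nice.balanced {V : Ctx L} {Ω : Sequent L V} {D : Deriv U Ω} {l l' : Location L}
    {A A' : UsageMap L} (h : D.Nice (A.at_ l ∪ A'.at_ l')) (hl : l.Disjoint l') : D.Balanced := by
  refine ⟨⟨h.1, h.2.1⟩, fun m k k' hk hk' => ?_, h.2.2.1⟩
  rcases h.2.2.2 hk with hk | hk <;> rcases h.2.2.2 hk' with hk' | hk'
  · exact A.at_functional hk hk'
  · obtain ⟨p, hp, -⟩ := hk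
    obtain ⟨q, hq, -⟩ := hk'
    exact absurd (hp.symm.trans hq) (hl.ext_ne p q)
  · obtain ⟨p, hp, -⟩ := hk
    obtain ⟨q, hq, -⟩ := hk'
    exact absurd (hq.symm.trans hp) (hl.ext_ne q p)
  · exact A'.at_functional hk hk'

end Deriv

/-- For all locations, the two formulas form a sequent with a derivation whose uses of greatest
fixed points are described by the two maps. -/
def Linked (U : UnifierSets L) {V : Ctx L} (A A' : UsageMap L) (P Q : Formula L [] V) : Prop :=
  ∀ l l' : Location L, ∃ D : Deriv U {act l P, act l' Q}, D.Nice (A.at_ l ∪ A'.at_ l')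

/-- The two formulas are linked for some description of the uses of greatest fixed points. -/
def Linkable (U : UnifierSets L) {V : Ctx L} (P Q : Formula L [] V) : Prop :=
  ∃ A A', Linked U A A' P Q

namespace Linked

variable {V : Ctx L} {A A' A₁ A₁' A₂ A₂' : UsageMap L}

theorem symm {P Q : Formula L [] V} (h : Linked U A A' P Q) : Linked U A' A Q P := by
  intro l l'
  have := h l' l
  rwa [Multiset.pair_comm, Set.union_comm] at this

theorem par_tensor {P P' Q Q' : Formula L [] V} (h₁ : Linked U A₁ A₁' P P')
    (h₂ : Linked U A₂ A₂' Q Q') :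
    Linked U (branch A₁ A₂) (branch A₁' A₂') (.par P Q) (.tensor P' Q') := by
  intro l l'
  obtain ⟨D₁, a₁, b₁, c₁, d₁⟩ := h₁.symm (l'.sub .left) (l.sub .left)
  obtain ⟨D₂, a₂, b₂, c₂, d₂⟩ := h₂.symm (l'.sub .right) (l.sub .right)
  refine ⟨.par {act l' (.tensor P' Q')} l P Q rfl
    (.tensor {act (l.sub .left) P} {act (l.sub .right) Q} l' P' Q' ?_ D₁ D₂), ?_, ?_, ?_, ?_⟩
  · rw [Multiset.singleton_add]
    simp only [← Multiset.cons_zero]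
    rw [Multiset.cons_swap _ (act l' _), Multiset.cons_swap _ (act l' _)]
  · simp [Deriv.height, a₁, a₂]
  · exact b₁.union b₂
  · exact ⟨c₁, c₂⟩
  · refine Set.union_subset (d₁.trans ?_) (d₂.trans ?_) <;> rw [Set.union_comm] <;>
      apply Set.union_subset_union
    exacts [at_left_subset .., at_left_subset .., at_right_subset .., at_right_subset ..]

/-- `R` keeps its location in both premises, so a single map `A'` must describe its use in both.
This is why `Linked` carries explicit maps. -/
theorem wth {P Q R : Formula L [] V} (h₁ : Linked U A₁ A' P R) (h₂ : Linked U A₂ A' Q R) :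
    Linked U (branch A₁ A₂) A' (.wth P Q) R := by
  intro l l'
  obtain ⟨D₁, a₁, b₁, c₁, d₁⟩ := h₁ (l.sub .left) l'
  obtain ⟨D₂, a₂, b₂, c₂, d₂⟩ := h₂ (l.sub .right) l'
  refine ⟨.wth {act l' R} l P Q rfl D₁ D₂, ?_, ?_, ?_, ?_⟩
  · simp [Deriv.height, a₁, a₂]
  · exact b₁.union b₂
  · exact ⟨c₁, c₂⟩
  · refine Set.union_subset (d₁.trans ?_) (d₂.trans ?_) <;>
      apply Set.union_subset_union_left
    exacts [at_left_subset .., at_right_subset ..]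

/-- The discarded disjunct is never used, so its map `B` is free. `wth_plus` chooses it so that both
branches of the `&` agree on the map of the sum. -/
theorem plusLeft {P P' Q : Formula L [] V} (h : Linked U A A' P Q) (B : UsageMap L) :
    Linked U (branch A B) A' (.plus P P') Q := by
  intro l l'
  obtain ⟨D, a, b, c, d⟩ := h (l.sub .left) l'
  refine ⟨.plusLeft {act l' Q} l P P' rfl D, ?_, b, c,
    d.trans (Set.union_subset_union_left _ (at_left_subset ..))⟩
  simp [Deriv.height, a]

theorem plusRight {P P' Q : Formula L [] V} (h : Linked U A A' P' Q) (B : UsageMap L) :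
    Linked U (branch B A) A' (.plus P P') Q := by
  intro l l'
  obtain ⟨D, a, b, c, d⟩ := h (l.sub .right) l'
  refine ⟨.plusRight {act l' Q} l P P' rfl D, ?_, b, c,
    d.trans (Set.union_subset_union_left _ (at_right_subset ..))⟩
  simp [Deriv.height, a]

theorem wth_plus {P P' Q Q' : Formula L [] V} (h₁ : Linked U A₁ A₁' P P')
    (h₂ : Linked U A₂ A₂' Q Q') :
    Linked U (branch A₁ A₂) (branch A₁' A₂') (.wth P Q) (.plus P' Q') :=
  wth (h₁.symm.plusLeft A₂').symm (h₂.symm.plusRight A₁').symm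

theorem bot_one : Linked U empty empty (.bot : Formula L [] V) .one := by
  intro l l'
  refine ⟨.bot {act l' .one} l rfl (.one l' rfl), ?_, ?_, trivial, ?_⟩
  · simp [Deriv.height, ENat.add_lt_top]
  · exact Set.finite_empty
  · exact Set.empty_subset _

theorem top_zero : Linked U empty empty (.top : Formula L [] V) .zero := by
  intro l l'
  refine ⟨.top {act l' .zero} l rfl, ?_, ?_, trivial, ?_⟩
  · simp [Deriv.height]
  · exact Set.finite_empty
  · exact Set.empty_subset _

theorem natom_atom {τ : Ctx L} (a : L.Atom τ) (ts : Sub L τ V) :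
    Linked U empty empty (.natom a ts : Formula L [] V) (.atom a ts) := by
  intro l l'
  refine ⟨.freezeAtom {act l' (.atom a ts)} l a ts rfl (.initAtom l l' a ts rfl),
    ?_, ?_, trivial, ?_⟩
  · simp [Deriv.height, ENat.add_lt_top]
  · exact Set.finite_empty
  · exact Set.empty_subset _

theorem nu_mu {τ : Ctx L} (B : Formula L [τ] τ) (ts : Sub L τ V) :
    Linked U (node (some .frozen) fun _ => empty) empty
      (.nu B.neg ts : Formula L [] V) (.mu B ts) := by
  intro l l'
  refine ⟨.freezeNu {act l' (.mu B ts)} l B.neg ts rfl (.initFix l l' B ts rfl),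
    ?_, ?_, trivial, ?_⟩
  · simp [Deriv.height, ENat.add_lt_top]
  · exact Set.finite_empty
  · refine Set.union_subset ?_ (Set.empty_subset _)
    rintro _ rfl
    exact .inl (mem_at_self _ _ rfl)

/-- Each element of a complete set of unifiers is a unifier, so it turns the equality into a
reflexive one. All premises have height 1, however many there are. -/
theorem neq_eq {a : Ty L.Base} (s t : Tm L V a) :
    Linked U empty empty (.neq s t : Formula L [] V) (.eq s t) := by
  intro l l'
  refine ⟨.neq {act l' (.eq s t)} l s t rfl fun θ =>
    .eq l' (s.subst θ.1.2) ?_, ?_, ?_, ?_, ?_⟩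
  · simp [Sequent.tsubst, Entry.tsubst, act, Formula.tsubst, U.isUnifier s t θ.1 θ.2]
  · have : (⨆ _ : U.csu s t, (1 : ℕ∞)) < ⊤ := lt_of_le_of_lt (iSup_le fun _ => le_rfl) (by simp)
    simpa [Deriv.height] using this
  · simp [Deriv.coinvariants]
  · simp [Deriv.CoinvarianceConsistent]
  · simp [Deriv.uses]

theorem all_ex {a : Ty L.Base} {P Q : Formula L [] (a :: V)} (h : Linked U A A' P Q) :
    Linked U (after none A) (after none A') (.all P) (.ex Q) := by
  intro l l'
  have hD := h.symm (l'.sub .body) (l.sub .body)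
  -- The existential is instantiated with the eigenvariable of the `∀` rule: weakening `Q` and
  -- instantiating with that variable gives `Q` back.
  have e : Q = (Q.tsubst (Sub.shift V a).lift).tsubst (Sub.inst (.var .zero)) := by
    rw [Formula.tsubst_tsubst, Sub.lift_shift_comp_inst, Formula.tsubst_id]
  rw [e] at hD
  obtain ⟨D, a, b, c, d⟩ := hD
  refine ⟨.all {act l' (.ex Q)} l P rfl (.ex {act (l.sub .body) P} l'
    (Q.tsubst (Sub.shift V _).lift) (.var .zero) (Multiset.pair_comm _ _) D), ?_, ?_, ?_,
    d.trans ?_⟩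
  · simp [Deriv.height, a]
  · exact b
  · exact c
  · rw [Set.union_comm]
    exact Set.union_subset_union (at_after_subset ..) (at_after_subset ..)

theorem mu {τ : Ctx L} {B : Formula L [τ] τ} {ts : Sub L τ V} {Q : Formula L [] V}
    (h : Linked U A A' ((B.apply (.mu B (Sub.id τ))).tsubst ts) Q) :
    Linked U (after none A) A' (.mu B ts) Q := by
  intro l l'
  obtain ⟨D, a, b, c, d⟩ := h (l.sub .unfold) l'
  refine ⟨.mu {act l' Q} l B ts rfl D, ?_, b, c,
    d.trans (Set.union_subset_union_left _ (at_after_subset ..))⟩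
  simp [Deriv.height, a]

theorem mu_id {τ : Ctx L} {B : Formula L [τ] τ} {Q : Formula L [] τ}
    (h : Linked U A A' (B.apply (.mu B (Sub.id τ))) Q) :
    Linked U (after none A) A' (.mu B (Sub.id τ)) Q :=
  mu (by rwa [Formula.tsubst_id])

/-- Coinduction, given a derivation of coinvariance. -/
theorem nu {τ : Ctx L} {B : Formula L [τ] τ} {S : Formula L [] τ} {ts : Sub L τ V}
    {Q : Formula L [] V} (hS : Linked U A₁ A₂ (B.apply S) S.neg)
    (h : Linked U A A' (S.tsubst ts) Q) :
    Linked U (after (some (.coinducted ⟨τ, S⟩)) A) A' (.nu B ts) Q := by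
  intro l l'
  obtain ⟨E, hE⟩ := hS ⟨0, []⟩ ⟨1, []⟩
  obtain ⟨D, a, b, c, d⟩ := h (l.sub (.coinv ⟨τ, S⟩)) l'
  have hE' := hE.balanced (Location.disjoint_of_root_ne (by simp))
  refine ⟨.nu {act l' Q} l B ts S rfl D E, ?_, ?_, ⟨c, hE'.2.2, hE'.2.1⟩, ?_⟩
  · exact ENat.add_lt_top.2 ⟨max_lt a hE.1, ENat.one_lt_top⟩
  · exact ((Set.finite_singleton _).union b).union hE.2.1
  · refine Set.union_subset ?_ (d.trans (Set.union_subset_union_left _ (at_after_subset ..)))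
    rintro _ rfl
    exact .inl (mem_at_self _ _ rfl)

end Linked

/-! ### Functoriality of monotonic operators. -/

namespace Linkable

variable {V : Ctx L}

theorem symm {P Q : Formula L [] V} : Linkable U P Q → Linkable U Q P :=
  fun ⟨_, _, h⟩ => ⟨_, _, h.symm⟩

theorem nu_mu {τ : Ctx L} (B : Formula L [τ] τ) (ts : Sub L τ V) :
    Linkable U (.nu B.neg ts : Formula L [] V) (.mu B ts) := ⟨_, _, Linked.nu_mu B ts⟩

/-- Greatest and least fixed points are linked when their bodies are. -/
theorem nu_mu_of_apply {τ : Ctx L} {B C : Formula L [τ] τ} (ts : Sub L τ V)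
    (h : Linkable U (B.apply (.nu C.neg (Sub.id τ))) (C.apply (.mu C (Sub.id τ)))) :
    Linkable U (.nu B ts : Formula L [] V) (.mu C ts) := by
  obtain ⟨A, A', h⟩ := h
  -- The coinvariant for `νB` is the dual of `μC`. In the coinvariance sequent its negation is `μC`
  -- again, and unfolding it leaves the hypothesis `h`.
  have hS : Linked U A (after none A') (B.apply (.nu C.neg (Sub.id τ)))
      (.nu C.neg (Sub.id τ) : Formula L [] τ).neg := by
    rw [Formula.neg, Formula.neg_neg]
    exact h.symm.mu_id.symm
  -- The main premise holds the coinvariant and `μC`: freezing and the axiom close it.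
  have hC := Linked.nu_mu (U := U) C ts
  rw [← Sub.id_comp ts] at hC
  have := Linked.nu (ts := ts) hS hC
  rw [Sub.id_comp] at this
  exact ⟨_, _, this⟩

/-- Functoriality of monotonic operators. -/
theorem psubst {Δ : List (Ctx L)} (P : Formula L Δ V) (ρ ρ' : Formula.PSub L Δ [])
    (h : ∀ ⦃τ : Ctx L⦄ (p : Var Δ τ) ⦃W : Ctx L⦄ (ts : Sub L τ W),
      Linkable U ((ρ p).tsubst ts) ((ρ' p).tsubst ts)) :
    Linkable U (P.psubst ρ) (P.neg.psubst ρ') := by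
  have cons : ∀ {Δ : List (Ctx L)} {τ : Ctx L} {ρ ρ' : Formula.PSub L Δ []}
      {S S' : Formula L [] τ},
      (∀ ⦃τ : Ctx L⦄ (p : Var Δ τ) ⦃W : Ctx L⦄ (ts : Sub L τ W),
        Linkable U ((ρ p).tsubst ts) ((ρ' p).tsubst ts)) →
      (∀ ⦃W : Ctx L⦄ (ts : Sub L τ W), Linkable U (S.tsubst ts) (S'.tsubst ts)) →
      ∀ ⦃υ : Ctx L⦄ (p : Var (τ :: Δ) υ) ⦃W : Ctx L⦄ (ts : Sub L υ W),
        Linkable U ((ρ.cons S p).tsubst ts) ((ρ'.cons S' p).tsubst ts) := by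
    intro Δ τ ρ ρ' S S' h hS υ p
    cases p with
    | zero => exact hS
    | succ p => exact h p
  induction P with
  | tensor P Q ihP ihQ =>
    obtain ⟨_, _, h₁⟩ := ihP ρ ρ' h
    obtain ⟨_, _, h₂⟩ := ihQ ρ ρ' h
    exact ⟨_, _, (h₁.symm.par_tensor h₂.symm).symm⟩
  | plus P Q ihP ihQ =>
    obtain ⟨_, _, h₁⟩ := ihP ρ ρ' h
    obtain ⟨_, _, h₂⟩ := ihQ ρ ρ' h
    exact ⟨_, _, (h₁.symm.wth_plus h₂.symm).symm⟩
  | par P Q ihP ihQ =>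
    obtain ⟨_, _, h₁⟩ := ihP ρ ρ' h
    obtain ⟨_, _, h₂⟩ := ihQ ρ ρ' h
    exact ⟨_, _, h₁.par_tensor h₂⟩
  | wth P Q ihP ihQ =>
    obtain ⟨_, _, h₁⟩ := ihP ρ ρ' h
    obtain ⟨_, _, h₂⟩ := ihQ ρ ρ' h
    exact ⟨_, _, h₁.wth_plus h₂⟩
  | one => exact ⟨_, _, Linked.bot_one.symm⟩
  | zero => exact ⟨_, _, Linked.top_zero.symm⟩
  | bot => exact ⟨_, _, Linked.bot_one⟩
  | top => exact ⟨_, _, Linked.top_zero⟩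
  | atom a ts => exact ⟨_, _, (Linked.natom_atom a ts).symm⟩
  | natom a ts => exact ⟨_, _, Linked.natom_atom a ts⟩
  | ex P ih =>
    obtain ⟨_, _, h₁⟩ := ih ρ ρ' h
    exact ⟨_, _, h₁.symm.all_ex.symm⟩
  | all P ih =>
    obtain ⟨_, _, h₁⟩ := ih ρ ρ' h
    exact ⟨_, _, h₁.all_ex⟩
  | eq s t => exact ⟨_, _, (Linked.neq_eq s t).symm⟩
  | neq s t => exact ⟨_, _, Linked.neq_eq s t⟩
  -- Here the greatest fixed point is on the negated side, so this is the `nu` case with the two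
  -- sides exchanged. In both cases the bound predicate variable is interpreted by a dual pair `ν`,
  -- `μ`, which freezing and the axiom link at all arguments.
  | mu B ts ih =>
    refine (nu_mu_of_apply (B := B.neg.psubst ρ'.lift) (C := B.psubst ρ.lift) ts ?_).symm
    rw [Formula.psubst_lift_apply, Formula.psubst_lift_apply]
    exact (ih _ _ (cons h fun W us => by simpa only [Formula.tsubst] using (nu_mu _ _).symm)).symm
  | nu B ts ih =>
    refine nu_mu_of_apply (B := B.psubst ρ.lift) (C := B.neg.psubst ρ'.lift) ts ?_
    rw [Formula.psubst_lift_apply, Formula.psubst_lift_apply]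
    exact ih _ _ (cons h fun W us => by simpa only [Formula.tsubst] using nu_mu _ _)
  | pvar p ts => exact h p ts

end Linkable

/-! ## Copies of a greatest fixed point -/

namespace Formula

/-- The sum of several copies of the greatest fixed point of `B`: one for each element of a list,
and one more. -/
def copies {τ : Ctx L} {α : Type*} (B : Formula L [τ] τ) : List α → Formula L [] τ
  | [] => .nu B (Sub.id τ)
  | _ :: r => .plus (.nu B (Sub.id τ)) (copies B r)

end Formula

/-- Sums of copies of a greatest fixed point are coinvariants. -/
theorem exists_balanced_copies {τ : Ctx L} {α : Type*} (U : UnifierSets L) (B : Formula L [τ] τ)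
    (r : List α) : ∃ E : Deriv U (coinvarianceSequent B (B.copies r)), E.Balanced := by
  have hnu : ∀ {W : Ctx L} (ts : Sub L τ W), Linkable U (.nu B ts : Formula L [] W)
      (.mu B.neg ts) := fun ts => by
    simpa only [Formula.neg_neg] using Linkable.nu_mu (U := U) B.neg ts
  obtain ⟨A, A', h⟩ : Linkable U (B.apply (B.copies r))
      (B.neg.apply (.mu B.neg (Sub.id τ))) := by
    -- By functoriality only the sum against the dual least fixed point is left; its first copy is
    -- enough.
    refine Linkable.psubst B _ _ fun υ p W ts => ?_
    cases p with
    | succ p => cases p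
    | zero =>
      obtain ⟨A, A', h⟩ := hnu ts
      cases r with
      | nil =>
        simp only [Formula.PSub.single, Formula.copies, Formula.tsubst, Sub.id_comp]
        exact hnu ts
      | cons S r =>
        simp only [Formula.PSub.single, Formula.copies, Formula.tsubst, Sub.id_comp]
        exact ⟨_, _, h.plusLeft empty⟩
  -- The induction peels off the `&` in the negated sum while `r` stays fixed inside `B`. The same
  -- map `A` serves all branches, as `B.apply (B.copies r)` has the same location in all of them.
  have hr : ∀ r' : List α, ∃ A'', Linked U A A'' (B.apply (B.copies r)) (B.copies r').neg := by
    intro r'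
    induction r' with
    | nil => exact ⟨_, h.symm.mu_id.symm⟩
    | cons S r' ih =>
      obtain ⟨A'', h'⟩ := ih
      exact ⟨_, (Linked.wth h.symm.mu_id h'.symm).symm⟩
  obtain ⟨A'', h'⟩ := hr r
  obtain ⟨E, hE⟩ := h' ⟨0, []⟩ ⟨1, []⟩
  exact ⟨E, hE.balanced (Location.disjoint_of_root_ne (by simp))⟩

/-! ## Uses of greatest fixed points in normalized derivations

All greatest fixed points are coinducted on with a sum of copies. The coinvariants of the original
derivation, given for each arity by a list, are used on the copies, and the last copy is frozen. -/

/-- What is found at a location: a formula, a sum of copies of a greatest fixed point, or a copy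
that is coinducted on. -/
inductive Stage (L : Lang.{u, v, w}) : Type (max u v w)
  | formula {V : Ctx L} (P : Formula L [] V)
  | copies {τ : Ctx L} (r : List (Formula L [] τ))
  | copy (S : ClosedPred L)
  | none

/-- For each arity, a list of coinvariants. -/
abbrev CoinvariantLists (L : Lang.{u, v, w}) : Type (max u v w) :=
  ∀ τ : Ctx L, List (Formula L [] τ)

namespace Stage

variable (c : CoinvariantLists L)

/-- The label of a coinduction is ignored, since normalized derivations coinduct on a formula's
greatest fixed point only with the sum of copies. Quantifier bodies are left uninstantiated, which
is harmless by `uses_tsubst`. -/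
noncomputable def formulaStep : ∀ {V : Ctx L}, Formula L [] V → Step L → Stage L
  | _, .tensor P _, .left => .formula P
  | _, .tensor _ Q, .right => .formula Q
  | _, .plus P _, .left => .formula P
  | _, .plus _ Q, .right => .formula Q
  | _, .par P _, .left => .formula P
  | _, .par _ Q, .right => .formula Q
  | _, .wth P _, .left => .formula P
  | _, .wth _ Q, .right => .formula Q
  | _, .ex P, .body => .formula P
  | _, .all P, .body => .formula P
  | _, .mu B _, .unfold => .formula (B.apply (.mu B (Sub.id _)))
  | _, .nu (τ := τ) _ _, .coinv _ => .copies (c τ)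
  | _, _, _ => .none

noncomputable def step : Stage L → Step L → Stage L
  | .formula P, s => formulaStep c P s
  | .copies (S :: _), .left => .copy ⟨_, S⟩
  | .copies (_ :: r), .right => .copies r
  | .copy S, .coinv _ => .formula S.2
  | _, _ => .none

def formulaUsage : ∀ {V : Ctx L}, Formula L [] V → Option (Usage L)
  | _, .nu (τ := τ) B _ => some (.coinducted ⟨τ, B.copies (c τ)⟩)
  | _, _ => Option.none

/-- The empty list stands for the last copy, a greatest fixed point reserved for freezing. A
nonempty list stands for a `⊕`, which has no use to record. -/
def usage : Stage L → Option (Usage L)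
  | .formula P => formulaUsage c P
  | .copies [] => some .frozen
  | .copy S => some (.coinducted S)
  | _ => Option.none

noncomputable def uses (s : Stage L) : UsageMap L := fun p => (p.foldl (step c) s).usage c

/-- Locations and operators do not depend on terms. Hence the premises of a disequality, or
different instantiations of an `∃`, obey the same map. -/
theorem uses_tsubst {V W : Ctx L} (σ : Sub L V W) (P : Formula L [] V) :
    (formula (P.tsubst σ)).uses c = (formula P).uses c := by
  funext p
  induction p generalizing V W with
  | nil => cases P <;> rfl
  | cons s p ih => cases P <;> cases s <;> first | rfl | exact ih _ _

theorem at_sub_subset (l : Location L) (st : Stage L) (s : Step L) :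
    ((st.step c s).uses c).at_ (l.sub s) ⊆ (st.uses c).at_ l := by
  rintro x ⟨p, hp, hk⟩
  exact ⟨s :: p, hp.trans (l.sub_ext s p), hk⟩

theorem at_formula_sub_subset {V W : Ctx L} (l : Location L) (P : Formula L [] V)
    (Q : Formula L [] W) (s : Step L) (h : formulaStep c P s = .formula Q) :
    ((formula Q).uses c).at_ (l.sub s) ⊆ ((formula P).uses c).at_ l := by
  have := at_sub_subset c l (.formula P) s
  rwa [step, h] at this

end Stage

namespace Sequent

/-- The uses of greatest fixed points in normalized derivations of a sequent. -/
def uses (c : CoinvariantLists L) {V : Ctx L} (Ω : Sequent L V) : Set (Location L × Usage L) :=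
  {x | ∃ e ∈ Ω, e.frozen = false ∧ x ∈ ((Stage.formula e.formula).uses c).at_ e.loc}

variable (c : CoinvariantLists L)

theorem uses_act {V : Ctx L} (l : Location L) (P : Formula L [] V) (Ω : Sequent L V) :
    uses c (act l P ::ₘ Ω) = ((Stage.formula P).uses c).at_ l ∪ uses c Ω := by
  ext x
  simp [uses, act]

theorem uses_frz {V : Ctx L} (l : Location L) (P : Formula L [] V) (Ω : Sequent L V) :
    uses c (frz l P ::ₘ Ω) = uses c Ω := by
  ext x
  simp [uses, frz]

theorem uses_add {V : Ctx L} (Ω Ω' : Sequent L V) :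
    uses c (Ω + Ω') = uses c Ω ∪ uses c Ω' := by
  ext x
  simp only [uses, Multiset.mem_add, Set.mem_ofPred_eq, Set.mem_union, or_and_right, exists_or]

theorem uses_tsubst {V W : Ctx L} (σ : Sub L V W) (Ω : Sequent L V) :
    uses c (Ω.tsubst σ) = uses c Ω := by
  ext x
  simp [uses, tsubst, Entry.tsubst, Stage.uses_tsubst]

/-- Within one formula the path determines the use; two different entries have disjoint subtrees.
Normalized derivations inherit consistency from this property of their conclusion alone. -/
theorem uses_functional {V : Ctx L} {Ω : Sequent L V}
    (h : Ω.Pairwise (fun e e' => e.loc.Disjoint e'.loc)) {m : Location L} {k k' : Usage L}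
    (hk : (m, k) ∈ uses c Ω) (hk' : (m, k') ∈ uses c Ω) : k = k' := by
  obtain ⟨es, rfl, hes⟩ := h
  obtain ⟨e, he, -, hk⟩ := hk
  obtain ⟨e', he', -, hk'⟩ := hk'
  by_cases hee : e = e'
  · subst hee
    exact at_functional _ hk hk'
  · obtain ⟨p, hp, -⟩ := hk
    obtain ⟨q, hq, -⟩ := hk'
    have : Std.Symm fun e e' : Entry L V => e.loc.Disjoint e'.loc :=
      ⟨fun e e' h ⟨m, h1, h2⟩ => h ⟨m, h2, h1⟩⟩
    exact absurd (hp.symm.trans hq)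
      ((hes.forall (by simpa using he) (by simpa using he') hee).ext_ne p q)

end Sequent

/-! ## The operators of the greatest fixed points that can be principal -/

/-- The operators of the greatest fixed points met in `n` steps from a formula, when coinvariants
are taken from given lists. -/
def Formula.operators (c : CoinvariantLists L) :
    ℕ → ∀ {V : Ctx L}, Formula L [] V → Set (Σ τ : Ctx L, Formula L [τ] τ)
  | 0, _, _ => ∅
  | n + 1, _, .tensor P Q => operators c n P ∪ operators c n Q
  | n + 1, _, .plus P Q => operators c n P ∪ operators c n Q
  | n + 1, _, .par P Q => operators c n P ∪ operators c n Q
  | n + 1, _, .wth P Q => operators c n P ∪ operators c n Q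
  | n + 1, _, .ex P => operators c n P
  | n + 1, _, .all P => operators c n P
  | n + 1, _, .mu B _ => operators c n (B.apply (.mu B (Sub.id _)))
  | n + 1, _, .nu (τ := τ) B _ => {⟨τ, B⟩} ∪ ⋃ S ∈ {S | S ∈ c τ},
      (operators c n S ∪ operators c n (B.apply S) ∪ operators c n S.neg)
  | _ + 1, _, _ => ∅

namespace Formula

variable (c : CoinvariantLists L)

/-- Arguments of fixed points are ignored and coinvariants come from finite lists, so each step has
finitely many outcomes. -/
theorem operators_finite (n : ℕ) {V : Ctx L} (P : Formula L [] V) :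
    (P.operators c n).Finite := by
  induction n generalizing V with
  | zero => exact Set.finite_empty
  | succ n ih =>
    cases P with
    | tensor P Q => exact (ih P).union (ih Q)
    | plus P Q => exact (ih P).union (ih Q)
    | par P Q => exact (ih P).union (ih Q)
    | wth P Q => exact (ih P).union (ih Q)
    | ex P => exact ih P
    | all P => exact ih P
    | mu B ts => exact ih _
    | nu B ts =>
      exact (Set.finite_singleton _).union ((List.finite_toSet _).biUnion fun S _ =>
        ((ih _).union (ih _)).union (ih _))
    | _ => exact Set.finite_empty

/-- Needed for the side formulas, which stay unchanged while a rule applied elsewhere consumes a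
unit of height. -/
theorem operators_mono (n : ℕ) {V : Ctx L} (P : Formula L [] V) :
    P.operators c n ⊆ P.operators c (n + 1) := by
  induction n generalizing V with
  | zero => exact Set.empty_subset _
  | succ n ih =>
    cases P with
    | tensor P Q => exact Set.union_subset_union (ih P) (ih Q)
    | plus P Q => exact Set.union_subset_union (ih P) (ih Q)
    | par P Q => exact Set.union_subset_union (ih P) (ih Q)
    | wth P Q => exact Set.union_subset_union (ih P) (ih Q)
    | ex P => exact ih P
    | all P => exact ih P
    | mu B ts => exact ih _
    | nu B ts =>
      exact Set.union_subset_union_right _ (Set.iUnion₂_mono fun S _ =>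
        Set.union_subset_union (Set.union_subset_union (ih _) (ih _)) (ih _))
    | _ => exact Set.empty_subset _

theorem operators_tsubst (n : ℕ) {V W : Ctx L} (σ : Sub L V W) (P : Formula L [] V) :
    (P.tsubst σ).operators c n = P.operators c n := by
  induction n generalizing V W with
  | zero => rfl
  | succ n ih =>
    cases P with
    | tensor P Q => exact congrArg₂ _ (ih σ P) (ih σ Q)
    | plus P Q => exact congrArg₂ _ (ih σ P) (ih σ Q)
    | par P Q => exact congrArg₂ _ (ih σ P) (ih σ Q)
    | wth P Q => exact congrArg₂ _ (ih σ P) (ih σ Q)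
    | ex P => exact ih _ P
    | all P => exact ih _ P
    | _ => rfl

end Formula

namespace Sequent

variable (c : CoinvariantLists L)

/-- The operators met in `n` steps from the formulas of a sequent all belong to a set. -/
def OperatorsIn (n : ℕ) (O : Set (Σ τ : Ctx L, Formula L [τ] τ)) {V : Ctx L}
    (Ω : Sequent L V) : Prop :=
  ∀ e ∈ Ω, e.formula.operators c n ⊆ O

variable {c} {n : ℕ} {O : Set (Σ τ : Ctx L, Formula L [τ] τ)} {V : Ctx L}

theorem operatorsIn_cons {e : Entry L V} {Ω : Sequent L V} :
    OperatorsIn c n O (e ::ₘ Ω) ↔ e.formula.operators c n ⊆ O ∧ OperatorsIn c n O Ω :=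
  Multiset.forall_mem_cons

theorem operatorsIn_singleton {e : Entry L V} :
    OperatorsIn c n O ({e} : Sequent L V) ↔ e.formula.operators c n ⊆ O := by
  simp [OperatorsIn]

theorem operatorsIn_add {Ω Ω' : Sequent L V} :
    OperatorsIn c n O (Ω + Ω') ↔ OperatorsIn c n O Ω ∧ OperatorsIn c n O Ω' := by
  simp only [OperatorsIn, Multiset.mem_add, or_imp, forall_and]

theorem OperatorsIn.of_succ {Ω : Sequent L V} (h : OperatorsIn c (n + 1) O Ω) :
    OperatorsIn c n O Ω := fun e he => (Formula.operators_mono c n _).trans (h e he)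

theorem OperatorsIn.tsubst {Ω : Sequent L V} (h : OperatorsIn c n O Ω) {W : Ctx L}
    (σ : Sub L V W) : OperatorsIn c n O (Ω.tsubst σ) := by
  intro e he
  obtain ⟨e, he', rfl⟩ := Multiset.mem_map.1 he
  exact (Formula.operators_tsubst c n σ e.formula).subset.trans (h e he')

/-- The two sequents are the same, up to locations. -/
abbrev Relocated (Ω Ω' : Sequent L V) : Prop :=
  Multiset.Rel (fun e e' => e'.formula = e.formula ∧ e'.frozen = e.frozen) Ω Ω'

theorem Relocated.refl (Ω : Sequent L V) : Relocated Ω Ω :=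
  Multiset.rel_refl_of_refl_on fun _ _ => ⟨rfl, rfl⟩

theorem Relocated.act_cons {l : Location L} {P : Formula L [] V} {Ω Ω' : Sequent L V}
    (h : Relocated (act l P ::ₘ Ω) Ω') :
    ∃ l' Ω'', Relocated Ω Ω'' ∧ Ω' = act l' P ::ₘ Ω'' := by
  obtain ⟨⟨l', P', b⟩, Ω'', ⟨hP, hb⟩, h', rfl⟩ := Multiset.rel_cons_left.1 h
  obtain rfl : P' = P := hP
  obtain rfl := hb
  exact ⟨l', Ω'', h', rfl⟩

theorem Relocated.frz_cons {l : Location L} {P : Formula L [] V} {Ω Ω' : Sequent L V}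
    (h : Relocated (frz l P ::ₘ Ω) Ω') :
    ∃ l' Ω'', Relocated Ω Ω'' ∧ Ω' = frz l' P ::ₘ Ω'' := by
  obtain ⟨⟨l', P', b⟩, Ω'', ⟨hP, hb⟩, h', rfl⟩ := Multiset.rel_cons_left.1 h
  obtain rfl : P' = P := hP
  obtain rfl := hb
  exact ⟨l', Ω'', h', rfl⟩

theorem Relocated.act_singleton {l : Location L} {P : Formula L [] V} {Ω' : Sequent L V}
    (h : Relocated {act l P} Ω') : ∃ l', Ω' = {act l' P} := by
  obtain ⟨l', Ω'', h', rfl⟩ := Relocated.act_cons h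
  obtain rfl := Multiset.rel_zero_left.1 h'
  exact ⟨l', rfl⟩

theorem Relocated.cons_act {Ω Ω' : Sequent L V} (h : Relocated Ω Ω') (l l' : Location L)
    (P : Formula L [] V) : Relocated (act l P ::ₘ Ω) (act l' P ::ₘ Ω') := h.cons ⟨rfl, rfl⟩

theorem Relocated.cons_frz {Ω Ω' : Sequent L V} (h : Relocated Ω Ω') (l l' : Location L)
    (P : Formula L [] V) : Relocated (frz l P ::ₘ Ω) (frz l' P ::ₘ Ω') := h.cons ⟨rfl, rfl⟩

theorem Relocated.tsubst {Ω Ω' : Sequent L V} (h : Relocated Ω Ω') {W : Ctx L} (σ : Sub L V W) :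
    Relocated (Ω.tsubst σ) (Ω'.tsubst σ) := by
  refine Multiset.rel_map.2 (h.mono fun e _ e' _ he => ⟨?_, he.2⟩)
  exact congrArg (Formula.tsubst σ) he.1

end Sequent

/-! ## Normalization -/

namespace Deriv

/-- Bounds on the height, the coinvariants and the uses of greatest fixed points of a derivation
whose coinvariance subderivations are consistent. -/
def Bounded {V : Ctx L} {Ω : Sequent L V} (D : Deriv U Ω) (N : ℕ) (T : Set (ClosedPred L))
    (W : Set (Location L × Usage L)) : Prop :=
  D.height ≤ N ∧ D.coinvariants ⊆ T ∧ D.CoinvarianceConsistent ∧ D.uses ⊆ W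

theorem exists_of_add_one_le {x : ℕ∞} {n : ℕ} (h : x + 1 ≤ n) : ∃ m : ℕ, n = m + 1 ∧ x ≤ m := by
  cases n with
  | zero => simp at h
  | succ m => exact ⟨m, rfl, (ENat.add_le_add_iff_right ENat.one_ne_top).1 (by simpa using h)⟩

theorem add_one_le_of_le {x : ℕ∞} {m N : ℕ} (h : x ≤ m) (hN : m + 1 ≤ N) : x + 1 ≤ N :=
  (add_le_add_left h 1).trans (by exact_mod_cast hN)

/-- Selecting a copy in a sum of copies of a greatest fixed point. -/
theorem exists_copy (c : CoinvariantLists L) {V : Ctx L} {τ : Ctx L} (B : Formula L [τ] τ)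
    (ts : Sub L τ V) (Γ : Sequent L V) (r : List (Formula L [] τ)) (st : Stage L)
    (hst : st = .copies ([] : List (Formula L [] τ)) ∨ ∃ S ∈ r, st = .copy ⟨τ, S⟩)
    (l : Location L) :
    ∃ m : Location L, (st.uses c).at_ m ⊆ ((Stage.copies r).uses c).at_ l ∧
      ∀ (N : ℕ) (T : Set (ClosedPred L)) (W : Set (Location L × Usage L))
        (D : Deriv U (act m (.nu B ts) ::ₘ Γ)), D.Bounded N T W →
        ∃ D' : Deriv U (act l ((B.copies r).tsubst ts) ::ₘ Γ), D'.Bounded (N + r.length) T W := by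
  induction r generalizing l with
  | nil =>
    obtain rfl : st = .copies ([] : List (Formula L [] τ)) := by simpa using hst
    refine ⟨l, subset_rfl, fun N T W D hD => ?_⟩
    rw [Formula.copies, Formula.tsubst, Sub.id_comp]
    exact ⟨D, hD⟩
  | cons S r ih =>
    -- The first occurrence of `S` is taken. The location `m` is thus fixed by the stage before any
    -- derivation is given, so the original rule can be replayed at `m`.
    by_cases hS : st = .copy ⟨τ, S⟩
    · subst hS
      refine ⟨l.sub .left, Stage.at_sub_subset c l (.copies (S :: r)) .left,
        fun N T W D hD => ?_⟩
      rw [Formula.copies, Formula.tsubst, Formula.tsubst, Sub.id_comp]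
      refine ⟨.plusLeft Γ l _ _ rfl D, add_one_le_of_le hD.1 ?_, hD.2⟩
      simp
    · obtain ⟨m, hm, h⟩ := ih (by simpa [hS] using hst) (l.sub .right)
      refine ⟨m, hm.trans (Stage.at_sub_subset c l (.copies (S :: r)) .right),
        fun N T W D hD => ?_⟩
      obtain ⟨D', hD'⟩ := h N T W D hD
      rw [Formula.copies, Formula.tsubst]
      exact ⟨.plusRight Γ l _ _ rfl D', add_one_le_of_le hD'.1 (by simp [add_assoc]), hD'.2⟩

/-- Coinduction with a sum of copies, followed by the selection of a copy. -/
theorem exists_coinduct_copies (c : CoinvariantLists L) {V : Ctx L} {τ : Ctx L}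
    (B : Formula L [τ] τ) (ts : Sub L τ V) (Γ : Sequent L V) (st : Stage L)
    (hst : st = .copies ([] : List (Formula L [] τ)) ∨ ∃ S ∈ c τ, st = .copy ⟨τ, S⟩)
    (l : Location L) {K : ℕ} {T : Set (ClosedPred L)} (hK : (c τ).length ≤ K)
    (hT : ⟨τ, B.copies (c τ)⟩ ∈ T) (E : Deriv U (coinvarianceSequent B (B.copies (c τ))))
    (hEK : E.height ≤ K) (hET : E.coinvariants ⊆ T) (hE : E.Balanced) :
    ∃ m : Location L,
      (st.uses c).at_ m ⊆ ((Stage.formula (.nu B ts : Formula L [] V)).uses c).at_ l ∧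
      ∀ (N : ℕ) (D : Deriv U (act m (.nu B ts) ::ₘ Γ)),
        D.Bounded N T (((Stage.formula (.nu B ts : Formula L [] V)).uses c).at_ l ∪ Γ.uses c) →
        ∃ D' : Deriv U (act l (.nu B ts) ::ₘ Γ),
          D'.Bounded (N + K + 1) T (Sequent.uses c (act l (.nu B ts) ::ₘ Γ)) := by
  obtain ⟨m, hm, h⟩ := exists_copy (U := U) c B ts Γ (c τ) st hst
    (l.sub (.coinv ⟨τ, B.copies (c τ)⟩))
  refine ⟨m, hm.trans (Stage.at_sub_subset c l (.formula (.nu B ts)) _), fun N D hD => ?_⟩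
  obtain ⟨D', h1, h2, h3, h4⟩ := h N T _ D hD
  refine ⟨.nu Γ l B ts _ rfl D' E, ?_, ?_, ⟨h3, hE.2.2, hE.2.1⟩, ?_⟩
  · refine add_one_le_of_le (max_le (h1.trans ?_) (hEK.trans ?_)) le_rfl
    · exact_mod_cast Nat.add_le_add_left hK N
    · exact_mod_cast Nat.le_add_left K N
  · exact Set.union_subset (Set.union_subset (Set.singleton_subset_iff.2 hT) h2) hET
  · rw [Sequent.uses_act]
    refine Set.union_subset ?_ h4
    rintro _ rfl
    exact .inl (mem_at_self _ _ rfl)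

end Deriv

theorem coinvarianceSequent_pairwise {τ : Ctx L} (B : Formula L [τ] τ) (S : Formula L [] τ) :
    (coinvarianceSequent B S).Pairwise (fun e e' => e.loc.Disjoint e'.loc) :=
  ⟨[act ⟨0, []⟩ (B.apply S), act ⟨1, []⟩ S.neg], rfl, by
    simpa using Location.disjoint_of_root_ne (by simp [act])⟩

namespace Deriv

/-- Normalization: all greatest fixed points are coinducted on with sums of copies, and the
original uses are moved to the copies. -/
theorem exists_bounded (c : CoinvariantLists L) (O : Set (Σ τ : Ctx L, Formula L [τ] τ)) (K : ℕ)
    (T : Set (ClosedPred L))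
    (hO : ∀ x ∈ O, (c x.1).length ≤ K ∧ ⟨x.1, x.2.copies (c x.1)⟩ ∈ T ∧
      ∃ E : Deriv U (coinvarianceSequent x.2 (x.2.copies (c x.1))),
        E.height ≤ K ∧ E.coinvariants ⊆ T ∧ E.Balanced)
    (hT : ∀ τ, ∀ S ∈ c τ, ⟨τ, S⟩ ∈ T) {V : Ctx L} {Ω : Sequent L V} (D : Deriv U Ω) :
    ∀ n : ℕ, D.height ≤ n → (∀ S ∈ D.coinvariants, S.2 ∈ c S.1) → Ω.OperatorsIn c n O →
      ∀ Ω' : Sequent L V, Ω.Relocated Ω' →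
        ∃ D' : Deriv U Ω', D'.Bounded (n * (K + 3)) T (Ω'.uses c) := by
  -- Each original rule costs at most `K + 2` levels: the rule itself, up to `K` selections in the
  -- sum and one coinduction. `K + 3` leaves one to spare.
  have hle : ∀ n : ℕ, n * (K + 3) + 1 ≤ (n + 1) * (K + 3) := fun n => by linarith
  have hone : ∀ n : ℕ, (1 : ℕ∞) ≤ ((n + 1) * (K + 3) : ℕ) := fun n => by
    exact_mod_cast (Nat.le_add_left 1 _).trans (hle n)
  have hleaf : ∀ {n : ℕ}, (1 : ℕ∞) ≤ n → ∃ m, n = m + 1 := fun {n} h =>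
    ⟨n - 1, (Nat.sub_add_cancel (by exact_mod_cast h)).symm⟩
  -- The statement ranges over all relocations of the conclusion, because selecting a copy moves the
  -- formulas below it to other locations. No disjointness is required: inclusion of the uses in
  -- `Ω'.uses c` is the whole invariant, and consistency is read off only at the root of each
  -- derivation.
  induction D with
  | initAtom l l' a ts h =>
    subst h
    intro n hn _ _ Ω' hΩ
    obtain ⟨n, rfl⟩ := hleaf hn
    obtain ⟨m, _, hΓ, rfl⟩ := Sequent.Relocated.frz_cons hΩ
    obtain ⟨m', rfl⟩ := Sequent.Relocated.act_singleton hΓ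
    exact ⟨.initAtom m m' a ts rfl, hone n, Set.empty_subset _, trivial, Set.empty_subset _⟩
  | initFix l l' B ts h =>
    subst h
    intro n hn _ _ Ω' hΩ
    obtain ⟨n, rfl⟩ := hleaf hn
    obtain ⟨m, _, hΓ, rfl⟩ := Sequent.Relocated.frz_cons hΩ
    obtain ⟨m', rfl⟩ := Sequent.Relocated.act_singleton hΓ
    exact ⟨.initFix m m' B ts rfl, hone n, Set.empty_subset _, trivial, Set.empty_subset _⟩
  | freezeAtom Γ l a ts h D ih =>
    subst h
    intro n hn hc ho Ω' hΩ
    obtain ⟨n, rfl, hD⟩ := exists_of_add_one_le hn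
    obtain ⟨m, Γ', hΓ, rfl⟩ := hΩ.act_cons
    obtain ⟨D', h1, h2, h3, h4⟩ := ih n hD hc
      (Sequent.operatorsIn_cons.2 ⟨(Sequent.operatorsIn_cons.1 ho.of_succ).1,
        (Sequent.operatorsIn_cons.1 ho.of_succ).2⟩) _ (hΓ.cons_frz l m _)
    refine ⟨.freezeAtom Γ' m a ts rfl D', add_one_le_of_le h1 (hle n), h2, h3, h4.trans ?_⟩
    rw [Sequent.uses_frz, Sequent.uses_act]
    exact Set.subset_union_right
  | freezeNu Γ l B ts h D ih =>
    subst h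
    intro n hn hc ho Ω' hΩ
    obtain ⟨n, rfl, hD⟩ := exists_of_add_one_le hn
    obtain ⟨m, Γ', hΓ, rfl⟩ := hΩ.act_cons
    obtain ⟨hK, hBT, E, hEK, hET, hE⟩ := hO ⟨_, B⟩ ((Sequent.operatorsIn_cons.1 ho).1 (.inl rfl))
    -- The original freezing is replayed on the last copy.
    obtain ⟨m', hm', hcopy⟩ := exists_coinduct_copies (U := U) c B ts Γ'
      (.copies ([] : List (Formula L [] _))) (.inl rfl) m hK hBT E hEK hET hE
    obtain ⟨D', h1, h2, h3, h4⟩ := ih n hD hc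
      (Sequent.operatorsIn_cons.2 ⟨(Sequent.operatorsIn_cons.1 ho.of_succ).1,
        (Sequent.operatorsIn_cons.1 ho.of_succ).2⟩) _ (hΓ.cons_frz l m' _)
    rw [Sequent.uses_frz] at h4
    obtain ⟨D'', h1', h'⟩ := hcopy (n * (K + 3) + 1) (.freezeNu Γ' m' B ts rfl D')
      ⟨add_one_le_of_le h1 le_rfl, h2, h3, Set.union_subset
        (Set.singleton_subset_iff.2 (.inl (hm' (mem_at_self _ _ rfl))))
        (h4.trans Set.subset_union_right)⟩
    exact ⟨D'', h1'.trans (by exact_mod_cast (by linarith)), h'⟩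
  | bot Γ l h D ih =>
    subst h
    intro n hn hc ho Ω' hΩ
    obtain ⟨n, rfl, hD⟩ := exists_of_add_one_le hn
    obtain ⟨m, Γ', hΓ, rfl⟩ := hΩ.act_cons
    obtain ⟨D', h1, h2, h3, h4⟩ := ih n hD hc (Sequent.operatorsIn_cons.1 ho).2.of_succ _ hΓ
    refine ⟨.bot Γ' m rfl D', add_one_le_of_le h1 (hle n), h2, h3, h4.trans ?_⟩
    rw [Sequent.uses_act]
    exact Set.subset_union_right
  | par Γ l P Q h D ih =>
    subst h
    intro n hn hc ho Ω' hΩ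
    obtain ⟨n, rfl, hD⟩ := exists_of_add_one_le hn
    obtain ⟨m, Γ', hΓ, rfl⟩ := hΩ.act_cons
    obtain ⟨hP, ho⟩ := Sequent.operatorsIn_cons.1 ho
    obtain ⟨hP, hQ⟩ := Set.union_subset_iff.1 hP
    obtain ⟨D', h1, h2, h3, h4⟩ := ih n hD hc
      (Sequent.operatorsIn_cons.2 ⟨hP, Sequent.operatorsIn_cons.2 ⟨hQ, ho.of_succ⟩⟩) _
      ((hΓ.cons_act _ (m.sub .right) _).cons_act _ (m.sub .left) _)
    refine ⟨.par Γ' m P Q rfl D', add_one_le_of_le h1 (hle n), h2, h3, h4.trans ?_⟩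
    rw [Sequent.uses_act, Sequent.uses_act, Sequent.uses_act, ← Set.union_assoc]
    exact Set.union_subset_union_left _ (Set.union_subset
      (Stage.at_formula_sub_subset c m _ _ _ rfl) (Stage.at_formula_sub_subset c m _ _ _ rfl))
  | tensor Γ₁ Γ₂ l P Q h D₁ D₂ ih₁ ih₂ =>
    subst h
    intro n hn hc ho Ω' hΩ
    obtain ⟨n, rfl, hD⟩ := exists_of_add_one_le hn
    obtain ⟨m, Γ', hΓ, rfl⟩ := hΩ.act_cons
    obtain ⟨Γ₁', Γ₂', hΓ₁, hΓ₂, rfl⟩ := Multiset.rel_add_left.1 hΓ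
    obtain ⟨hP, ho⟩ := Sequent.operatorsIn_cons.1 ho
    obtain ⟨hP, hQ⟩ := Set.union_subset_iff.1 hP
    obtain ⟨ho₁, ho₂⟩ := Sequent.operatorsIn_add.1 ho.of_succ
    obtain ⟨D₁', a1, a2, a3, a4⟩ := ih₁ n ((le_max_left _ _).trans hD) (fun S hS => hc S (.inl hS))
      (Sequent.operatorsIn_cons.2 ⟨hP, ho₁⟩) _ (Sequent.Relocated.cons_act hΓ₁ _ (m.sub .left) _)
    obtain ⟨D₂', b1, b2, b3, b4⟩ := ih₂ n ((le_max_right _ _).trans hD) (fun S hS => hc S (.inr hS))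
      (Sequent.operatorsIn_cons.2 ⟨hQ, ho₂⟩) _ (Sequent.Relocated.cons_act hΓ₂ _ (m.sub .right) _)
    refine ⟨.tensor Γ₁' Γ₂' m P Q rfl D₁' D₂', add_one_le_of_le (max_le a1 b1) (hle n),
      Set.union_subset a2 b2, ⟨a3, b3⟩, Set.union_subset (a4.trans ?_) (b4.trans ?_)⟩ <;>
      rw [Sequent.uses_act, Sequent.uses_act, Sequent.uses_add]
    · exact Set.union_subset_union (Stage.at_formula_sub_subset c m _ _ _ rfl)
        Set.subset_union_left
    · exact Set.union_subset_union (Stage.at_formula_sub_subset c m _ _ _ rfl)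
        Set.subset_union_right
  | one l h =>
    subst h
    intro n hn _ _ Ω' hΩ
    obtain ⟨n, rfl⟩ := hleaf hn
    obtain ⟨m, rfl⟩ := hΩ.act_singleton
    exact ⟨.one m rfl, hone n, Set.empty_subset _, trivial, Set.empty_subset _⟩
  | top Γ l h =>
    subst h
    intro n hn _ _ Ω' hΩ
    obtain ⟨n, rfl⟩ := hleaf hn
    obtain ⟨m, Γ', hΓ, rfl⟩ := hΩ.act_cons
    exact ⟨.top Γ' m rfl, hone n, Set.empty_subset _, trivial, Set.empty_subset _⟩
  | wth Γ l P Q h D₁ D₂ ih₁ ih₂ =>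
    subst h
    intro n hn hc ho Ω' hΩ
    obtain ⟨n, rfl, hD⟩ := exists_of_add_one_le hn
    obtain ⟨m, Γ', hΓ, rfl⟩ := hΩ.act_cons
    obtain ⟨hP, ho⟩ := Sequent.operatorsIn_cons.1 ho
    obtain ⟨hP, hQ⟩ := Set.union_subset_iff.1 hP
    obtain ⟨D₁', a1, a2, a3, a4⟩ := ih₁ n ((le_max_left _ _).trans hD) (fun S hS => hc S (.inl hS))
      (Sequent.operatorsIn_cons.2 ⟨hP, ho.of_succ⟩) _ (hΓ.cons_act _ (m.sub .left) _)
    obtain ⟨D₂', b1, b2, b3, b4⟩ := ih₂ n ((le_max_right _ _).trans hD) (fun S hS => hc S (.inr hS))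
      (Sequent.operatorsIn_cons.2 ⟨hQ, ho.of_succ⟩) _ (hΓ.cons_act _ (m.sub .right) _)
    refine ⟨.wth Γ' m P Q rfl D₁' D₂', add_one_le_of_le (max_le a1 b1) (hle n),
      Set.union_subset a2 b2, ⟨a3, b3⟩, Set.union_subset (a4.trans ?_) (b4.trans ?_)⟩ <;>
      rw [Sequent.uses_act, Sequent.uses_act] <;>
      exact Set.union_subset_union_left _ (Stage.at_formula_sub_subset c m _ _ _ rfl)
  | plusLeft Γ l P Q h D ih =>
    subst h
    intro n hn hc ho Ω' hΩ
    obtain ⟨n, rfl, hD⟩ := exists_of_add_one_le hn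
    obtain ⟨m, Γ', hΓ, rfl⟩ := hΩ.act_cons
    obtain ⟨hP, ho⟩ := Sequent.operatorsIn_cons.1 ho
    obtain ⟨hP, hQ⟩ := Set.union_subset_iff.1 hP
    obtain ⟨D', h1, h2, h3, h4⟩ := ih n hD hc (Sequent.operatorsIn_cons.2 ⟨hP, ho.of_succ⟩) _
      (hΓ.cons_act _ (m.sub .left) _)
    refine ⟨.plusLeft Γ' m P Q rfl D', add_one_le_of_le h1 (hle n), h2, h3, h4.trans ?_⟩
    rw [Sequent.uses_act, Sequent.uses_act]
    exact Set.union_subset_union_left _ (Stage.at_formula_sub_subset c m _ _ _ rfl)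
  | plusRight Γ l P Q h D ih =>
    subst h
    intro n hn hc ho Ω' hΩ
    obtain ⟨n, rfl, hD⟩ := exists_of_add_one_le hn
    obtain ⟨m, Γ', hΓ, rfl⟩ := hΩ.act_cons
    obtain ⟨hP, ho⟩ := Sequent.operatorsIn_cons.1 ho
    obtain ⟨hP, hQ⟩ := Set.union_subset_iff.1 hP
    obtain ⟨D', h1, h2, h3, h4⟩ := ih n hD hc (Sequent.operatorsIn_cons.2 ⟨hQ, ho.of_succ⟩) _
      (hΓ.cons_act _ (m.sub .right) _)
    refine ⟨.plusRight Γ' m P Q rfl D', add_one_le_of_le h1 (hle n), h2, h3, h4.trans ?_⟩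
    rw [Sequent.uses_act, Sequent.uses_act]
    exact Set.union_subset_union_left _ (Stage.at_formula_sub_subset c m _ _ _ rfl)
  | all Γ l P h D ih =>
    subst h
    intro n hn hc ho Ω' hΩ
    obtain ⟨n, rfl, hD⟩ := exists_of_add_one_le hn
    obtain ⟨m, Γ', hΓ, rfl⟩ := hΩ.act_cons
    obtain ⟨hP, ho⟩ := Sequent.operatorsIn_cons.1 ho
    obtain ⟨D', h1, h2, h3, h4⟩ := ih n hD hc
      (Sequent.operatorsIn_cons.2 ⟨hP, ho.of_succ.tsubst _⟩) _
      ((hΓ.tsubst _).cons_act _ (m.sub .body) _)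
    refine ⟨.all Γ' m P rfl D', add_one_le_of_le h1 (hle n), h2, h3, h4.trans ?_⟩
    rw [Sequent.uses_act, Sequent.uses_act, Sequent.uses_tsubst]
    exact Set.union_subset_union_left _ (Stage.at_formula_sub_subset c m _ _ _ rfl)
  | ex Γ l P t h D ih =>
    subst h
    intro n hn hc ho Ω' hΩ
    obtain ⟨n, rfl, hD⟩ := exists_of_add_one_le hn
    obtain ⟨m, Γ', hΓ, rfl⟩ := hΩ.act_cons
    obtain ⟨hP, ho⟩ := Sequent.operatorsIn_cons.1 ho
    obtain ⟨D', h1, h2, h3, h4⟩ := ih n hD hc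
      (Sequent.operatorsIn_cons.2
        ⟨(Formula.operators_tsubst c n _ P).subset.trans hP, ho.of_succ⟩) _
      (hΓ.cons_act _ (m.sub .body) _)
    refine ⟨.ex Γ' m P t rfl D', add_one_le_of_le h1 (hle n), h2, h3, h4.trans ?_⟩
    rw [Sequent.uses_act, Sequent.uses_act, Stage.uses_tsubst]
    exact Set.union_subset_union_left _ (Stage.at_formula_sub_subset c m _ _ _ rfl)
  | neq Γ l s t h D ih =>
    subst h
    intro n hn hc ho Ω' hΩ
    obtain ⟨n, rfl, hD⟩ := exists_of_add_one_le hn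
    obtain ⟨m, Γ', hΓ, rfl⟩ := hΩ.act_cons
    -- The bounds do not depend on `θ`, so they survive the possibly infinite family of premises.
    choose D' h1 h2 h3 h4 using fun θ => ih θ n ((le_iSup (fun θ => (D θ).height) θ).trans hD)
      (fun S hS => hc S (Set.mem_iUnion.2 ⟨θ, hS⟩))
      ((Sequent.operatorsIn_cons.1 ho).2.of_succ.tsubst θ.1.2) _ (hΓ.tsubst θ.1.2)
    refine ⟨.neq Γ' m s t rfl D', add_one_le_of_le (iSup_le h1) (hle n),
      Set.iUnion_subset h2, h3, Set.iUnion_subset fun θ => (h4 θ).trans ?_⟩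
    rw [Sequent.uses_act, Sequent.uses_tsubst]
    exact Set.subset_union_right
  | eq l t h =>
    subst h
    intro n hn _ _ Ω' hΩ
    obtain ⟨n, rfl⟩ := hleaf hn
    obtain ⟨m, rfl⟩ := hΩ.act_singleton
    exact ⟨.eq m t rfl, hone n, Set.empty_subset _, trivial, Set.empty_subset _⟩
  | mu Γ l B ts h D ih =>
    subst h
    intro n hn hc ho Ω' hΩ
    obtain ⟨n, rfl, hD⟩ := exists_of_add_one_le hn
    obtain ⟨m, Γ', hΓ, rfl⟩ := hΩ.act_cons
    obtain ⟨hP, ho⟩ := Sequent.operatorsIn_cons.1 ho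
    obtain ⟨D', h1, h2, h3, h4⟩ := ih n hD hc
      (Sequent.operatorsIn_cons.2
        ⟨(Formula.operators_tsubst c n _ _).subset.trans hP, ho.of_succ⟩) _
      (hΓ.cons_act _ (m.sub .unfold) _)
    refine ⟨.mu Γ' m B ts rfl D', add_one_le_of_le h1 (hle n), h2, h3, h4.trans ?_⟩
    rw [Sequent.uses_act, Sequent.uses_act, Stage.uses_tsubst]
    exact Set.union_subset_union_left _ (Stage.at_formula_sub_subset c m _ _ _ rfl)
  | @nu V _ τ Γ l B ts S h D E' ih ih' =>
    subst h
    intro n hn hc ho Ω' hΩ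
    obtain ⟨n, rfl, hD⟩ := exists_of_add_one_le hn
    obtain ⟨m, Γ', hΓ, rfl⟩ := hΩ.act_cons
    obtain ⟨hP, ho⟩ := Sequent.operatorsIn_cons.1 ho
    obtain ⟨hB, hS⟩ := Set.union_subset_iff.1 hP
    have hSc : S ∈ c τ := hc ⟨τ, S⟩ (.inl (.inl rfl))
    have hS := Set.iUnion₂_subset_iff.1 hS S hSc
    obtain ⟨hS, hS₂⟩ := Set.union_subset_iff.1 hS
    obtain ⟨hS, hS₁⟩ := Set.union_subset_iff.1 hS
    -- The coinvariance derivation is normalized at its own locations. The same `n` works because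
    -- `height` counts it, and `operators` includes the two formulas of its conclusion.
    obtain ⟨E'', a1, a2, a3, a4⟩ := ih' n ((le_max_right _ _).trans hD)
      (fun S hS => hc S (.inr hS))
      (Sequent.operatorsIn_cons.2 ⟨hS₁, Sequent.operatorsIn_singleton.2 hS₂⟩) _
      (Sequent.Relocated.refl _)
    have hE'' : E''.Consistent := fun l k k' hk hk' =>
      Sequent.uses_functional c (coinvarianceSequent_pairwise B S) (a4 hk) (a4 hk')
    obtain ⟨hK, hBT, E, hEK, hET, hE⟩ := hO ⟨τ, B⟩ (hB rfl)
    -- The original coinduction is replayed on the copy reserved for `S`.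
    obtain ⟨m', hm', hcopy⟩ := exists_coinduct_copies (U := U) c B ts Γ'
      (.copy ⟨τ, S⟩) (.inr ⟨S, hSc, rfl⟩) m hK hBT E hEK hET hE
    obtain ⟨D', h1, h2, h3, h4⟩ := ih n ((le_max_left _ _).trans hD)
      (fun S hS => hc S (.inl (.inr hS)))
      (Sequent.operatorsIn_cons.2
        ⟨(Formula.operators_tsubst c n _ _).subset.trans hS, ho.of_succ⟩) _
      (hΓ.cons_act _ (m'.sub (.coinv ⟨τ, S⟩)) _)
    rw [Sequent.uses_act, Stage.uses_tsubst] at h4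
    obtain ⟨D'', h1', h'⟩ := hcopy (n * (K + 3) + 1) (.nu Γ' m' B ts S rfl D' E'')
      ⟨add_one_le_of_le (max_le h1 a1) le_rfl,
        Set.union_subset (Set.union_subset (Set.singleton_subset_iff.2 (hT τ S hSc)) h2) a2,
        ⟨h3, a3, hE''⟩, Set.union_subset
          (Set.singleton_subset_iff.2 (.inl (hm' (mem_at_self _ _ rfl))))
          (h4.trans (Set.union_subset_union_left _
            ((Stage.at_sub_subset c m' (.copy ⟨τ, S⟩) _).trans hm')))⟩
    exact ⟨D'', h1'.trans (by exact_mod_cast (by linarith)), h'⟩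

/-- Quasi-finite derivations can be balanced. -/
theorem exists_balanced {V : Ctx L} {Γ : Sequent L V}
    (hΓ : Γ.Pairwise (fun e e' => e.loc.Disjoint e'.loc)) (D : Deriv U Γ) (hD : D.QuasiFinite) :
    ∃ D' : Deriv U Γ, D'.Balanced := by
  obtain ⟨hh, hc⟩ := hD
  obtain ⟨n, hn⟩ := ENat.ne_top_iff_exists.1 hh.ne
  have hfin : ∀ τ : Ctx L, {S : Formula L [] τ | (⟨τ, S⟩ : ClosedPred L) ∈ D.coinvariants}.Finite :=
    fun τ => hc.preimage sigma_mk_injective.injOn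
  -- All coinvariants of arity `τ` are listed, even those never used with a given operator: an
  -- unused copy does no harm.
  let c : CoinvariantLists L := fun τ => (hfin τ).toFinset.toList
  have hcmem : ∀ τ S, S ∈ c τ ↔ (⟨τ, S⟩ : ClosedPred L) ∈ D.coinvariants := fun τ S => by
    simp [c]
  let O : Set (Σ τ : Ctx L, Formula L [τ] τ) := ⋃ e ∈ {e | e ∈ Γ}, e.formula.operators c n
  have hOfin : O.Finite := by
    exact (Multiset.finite_toSet Γ).biUnion fun e _ => Formula.operators_finite c n _
  choose E hE using fun x : Σ τ : Ctx L, Formula L [τ] τ =>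
    exists_balanced_copies U x.2 (c x.1)
  choose k hk using fun x => ENat.ne_top_iff_exists.1 (hE x).1.1.ne
  -- A bound on the sum bounds both the number of selections and the height of the coinvariance
  -- derivation, uniformly over the finite set `O`.
  obtain ⟨K, hK⟩ : ∃ K : ℕ, ∀ x ∈ O, (c x.1).length + k x ≤ K := by
    obtain ⟨K, hK⟩ := (hOfin.image fun x => (c x.1).length + k x).bddAbove
    exact ⟨K, fun x hx => hK ⟨x, hx, rfl⟩⟩
  -- The original coinvariants, the sums of copies, and whatever is used in proving the latter
  -- coinvariant: a finite set.
  let T : Set (ClosedPred L) := D.coinvariants ∪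
    ⋃ x ∈ O, ({⟨x.1, x.2.copies (c x.1)⟩} ∪ (E x).coinvariants)
  have hTfin : T.Finite := hc.union (hOfin.biUnion fun x _ =>
    (Set.finite_singleton _).union (hE x).1.2)
  have hOT : ∀ x ∈ O, {⟨x.1, x.2.copies (c x.1)⟩} ∪ (E x).coinvariants ⊆ T := fun x hx =>
    (Set.subset_biUnion_of_mem (u := fun x : Σ τ : Ctx L, Formula L [τ] τ =>
      ({⟨x.1, x.2.copies (c x.1)⟩} ∪ (E x).coinvariants : Set (ClosedPred L))) hx).trans
      Set.subset_union_right
  obtain ⟨D', h1, h2, h3, h4⟩ := exists_bounded c O K T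
    (fun x hx => ⟨(Nat.le_add_right _ _).trans (hK x hx), hOT x hx (.inl rfl), E x, by
      rw [← hk x]
      exact_mod_cast (Nat.le_add_left _ _).trans (hK x hx),
      Set.subset_union_right.trans (hOT x hx), hE x⟩)
    (fun τ S hS => .inl ((hcmem τ S).1 hS)) D n hn.ge (fun S hS => (hcmem S.1 S.2).2 hS)
    (fun e he => Set.subset_biUnion_of_mem (u := fun e : Entry L V => e.formula.operators c n) he)
    Γ (Sequent.Relocated.refl Γ)
  exact ⟨D', ⟨h1.trans_lt (ENat.natCast_lt_top _), hTfin.subset h2⟩,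
    fun l k k' hk hk' => Sequent.uses_functional c hΓ (h4 hk) (h4 hk'), h3⟩

end Deriv

end MuMALL

theorem mainTheorem7 {L : MuMALL.Lang.{u, v, w}} (U : MuMALL.UnifierSets L)
    (V : MuMALL.Ctx L) (Γ : MuMALL.Sequent L V) (hΓ : Γ.WellFormed)
    (D : MuMALL.Deriv U Γ) (hD : D.QuasiFinite) :
    ∃ D' : MuMALL.Deriv U Γ, D'.Balanced :=
  MuMALL.Deriv.exists_balanced hΓ.1 D hD
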